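/- **Theorem 3.25.** *Conventions.* Let $F$ be a hyperfield (commutative, with multivalued addition $\boxplus$ satisfying reversibility) endowed with an involution $x\mapsto\bar x$, and let $E$ be a finite set. For $X\in F^E$ write $\underline X=\{e\in E: X(e)\neq 0\}$ for its support, and for $\mathcal S\subseteq F^E$ let $\mathrm{SuppMin}(\mathcal S)$ be the set of elements of $\mathcal S$ of minimal support. Write $X\perp Y$ if $0\in\boxplus_{e\in E}X(e)\,\overline{Y(e)}$. A set $\mathcal C\subseteq F^E$ is the set of $F$-circuits of a *weak $F$-matroid* on $E$ if * (C0) $0\notin\mathcal C$; * (C1) $\alpha X\in\mathcal C$ for all $X\in\mathcal C$, $\alpha\in F^\times$; * (C2) if $X,Y\in\mathcal C$ and $\underline X\subseteq\underline Y$, then $X=\alpha Y$ for some $\alpha\in F^\times$; * (C3)$'$ if $X,Y\in\mathcal C$, $\underline X\ne\underline Y$, the set $\underline X\cup\underline Y$ does not properly contain a union of two distinct supports of elements of $\mathcal C$, and $X(e)=-Y(e)\neq0$, then there is $Z\in\mathcal C$ with $Z(e)=0$ and $Z(f)\in X(f)\boxplus Y(f)$ for all $f\in E$. It is the set of $F$-circuits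 of a *strong $F$-matroid* on $E$ if it satisfies (C0), (C1), (C2) and * (C3) whenever $X,X_1,\dots,X_k\in\mathcal C$ are such that $\underline X\cup\bigcup_i\underline{X_i}$ has height $k+1$ in the lattice (under inclusion) of all unions of supports of elements of $\mathcal C$, $\underline X\not\subseteq\bigcup_i\underline{X_i}$, and $e_i\in(\underline X\cap\underline{X_i})\setminus\bigcup_{j\ne i}\underline{X_j}$ satisfy $X(e_i)=-X_i(e_i)\ne0$ for $1\le i\le k$, there is $Z\in\mathcal C$ with $Z(e_i)=0$ for all $i$ and $Z(f)\in X(f)\boxplus X_1(f)\boxplus\cdots\boxplus X_k(f)$ for all $f\in E$. The *underlying matroid* $\underline M$ of such an $F$-matroid $M$ is the matroid on $E$ whose circuits are the supports of the elements of $\mathcal C$. The *dual* $M^*$ is the $F$-matroid whose $F$-circuits are $$\mathcal C^*=\mathrm{SuppMin}\bigl(\{Y\in F^E\setminus\{0\}: Y\perp X\text{ for all }X\in\mathcal C\}\bigr)$$ if $M$ is a strong $F$-matroid, and $$\mathcal C^*=\mathrm{SuppMin}\bigl(\{Y\in F^E\setminus\{0\}: Y\perp X\text{ for all }X\in\mathcal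 C\text{ with }|\underline X\cap\underline Y|\le3\}\bigr)$$ if $M$ is a weak $F$-matroid. For $A\subseteq E$ and $X\in F^E$ let $X\setminus A\in F^{E\setminus A}$ be the restriction of $X$ to $E\setminus A$, and put $$\mathcal C\setminus A=\{X\setminus A: X\in\mathcal C,\ \underline X\cap A=\emptyset\},\qquad \mathcal C/A=\mathrm{SuppMin}\bigl(\{X\setminus A: X\in\mathcal C\}\setminus\{0\}\bigr).$$ *Statement.* Let $\mathcal C$ be the set of $F$-circuits of a strong (resp. weak) $F$-matroid $M$ on $E$, and let $A\subseteq E$. Then the underlying matroid $\underline M$ exists, and 1. $\mathcal C\setminus A$ is the set of $F$-circuits of a strong (resp. weak) $F$-matroid $M\setminus A$ on $E\setminus A$, whose underlying matroid is the classical deletion $\underline M\setminus A$; 2. $\mathcal C/A$ is the set of $F$-circuits of a strong (resp. weak) $F$-matroid $M/A$ on $E\setminus A$, whose underlying matroid is the classical contraction $\underline M/A$; 3. $\mathcal C^*$ is the set of $F$-circuits of a strong (resp. weak) $F$-matroid $M^*$ on $E$, whose underlying matroid is the classical dual $\underline M^*$, and $(M\setminus A)^*=M^*/A$ and $(M/A)^*=M^*\setminus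 A$, that is, $(\mathcal C\setminus A)^*=\mathcal C^*/A$ and $(\mathcal C/A)^*=\mathcal C^*\setminus A$. -/

import Mathlib

open scoped Matroid

namespace HypMat

/-- A (commutative) hyperfield. The multiplicative structure is a commutative monoid with an
absorbing zero, in which `0 ≠ 1` and every nonzero element is invertible; `hadd x y` is the
hypersum of `x` and `y`, a nonempty subset of `F`; `-x` is the hyperinverse of `x`. -/
class Hyperfield (F : Type*) extends CommGroupWithZero F, Neg F where
  hadd : F → F → Set F
  hadd_nonempty : ∀ x y, (hadd x y).Nonempty
  hadd_comm : ∀ x y, hadd x y = hadd y x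
  hadd_assoc : ∀ x y z, (⋃ t ∈ hadd y z, hadd x t) = ⋃ t ∈ hadd x y, hadd t z
  zero_hadd : ∀ x, hadd 0 x = {x}
  zero_mem_hadd_neg : ∀ x, (0 : F) ∈ hadd x (-x)
  eq_neg_of_zero_mem_hadd : ∀ x y, (0 : F) ∈ hadd x y → y = -x
  reversible : ∀ x y z, x ∈ hadd y z ↔ z ∈ hadd x (-y)
  mul_hadd : ∀ a x y, (fun t => a * t) '' hadd x y = hadd (a * x) (a * y)

open Hyperfield (hadd)

section

variable {F : Type*} [Hyperfield F]

/-- The hypersum of an element and a set. -/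
def haddSet (x : F) (S : Set F) : Set F := ⋃ t ∈ S, hadd x t

theorem haddSet_left_comm (x y : F) (S : Set F) :
    haddSet x (haddSet y S) = haddSet y (haddSet x S) := by
  have key : ∀ a b : F, haddSet a (haddSet b S) = ⋃ s ∈ S, ⋃ t ∈ hadd a b, hadd t s := by
    intro a b
    have h : ∀ s, (⋃ t ∈ hadd a b, hadd t s) = ⋃ t ∈ hadd b s, hadd a t :=
      fun s => (Hyperfield.hadd_assoc a b s).symm
    simp only [h]
    ext z
    simp only [haddSet, Set.mem_iUnion, exists_prop]
    constructor
    · rintro ⟨t, ⟨s, hs, ht⟩, hz⟩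
      exact ⟨s, hs, t, ht, hz⟩
    · rintro ⟨s, hs, t, ht, hz⟩
      exact ⟨t, ⟨s, hs, ht⟩, hz⟩
  rw [key x y, key y x, Hyperfield.hadd_comm x y]

instance : LeftCommutative (haddSet (F := F)) := ⟨haddSet_left_comm⟩

/-- The hypersum `x₁ ⊞ (x₂ ⊞ ⋯ ⊞ xₘ)` of a finite multiset of elements; the empty hypersum is
`{0}`, the hypersum of a single element `x` is `{x}`. -/
def hyperSum (s : Multiset F) : Set F := s.foldr haddSet {0}

/-- The hypersum of a family indexed by a finite type. -/
noncomputable def hyperSumOver {ι : Type*} [Finite ι] (x : ι → F) : Set F :=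
  letI := Fintype.ofFinite ι
  hyperSum ((Finset.univ : Finset ι).val.map x)

end

/-- An involution of a hyperfield: an additive and multiplicative map that squares to the
identity. -/
structure Involution (F : Type*) [Hyperfield F] where
  toFun : F → F
  map_zero : toFun 0 = 0
  map_one : toFun 1 = 1
  map_mul : ∀ x y, toFun (x * y) = toFun x * toFun y
  map_hadd : ∀ x y, toFun '' hadd x y = hadd (toFun x) (toFun y)
  involutive : ∀ x, toFun (toFun x) = x

section

variable {F E : Type*} [Hyperfield F]

/-- The supports of the elements of `C`. -/
def supports (C : Set (E → F)) : Set (Set E) := Function.support '' C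

/-- The elements of `S` of minimal support. -/
def suppMin (S : Set (E → F)) : Set (E → F) :=
  {X | X ∈ S ∧ ∀ Y ∈ S, Function.support Y ⊆ Function.support X →
    Function.support X ⊆ Function.support Y}

/-- `C₁` and `C₂` form a modular pair in the family `𝒮`: they are distinct and `C₁ ∪ C₂` does not
properly contain a union of two distinct elements of `𝒮`. -/
def IsModularPair (𝒮 : Set (Set E)) (C₁ C₂ : Set E) : Prop :=
  C₁ ∈ 𝒮 ∧ C₂ ∈ 𝒮 ∧ C₁ ≠ C₂ ∧ ∀ D₁ ∈ 𝒮, ∀ D₂ ∈ 𝒮, D₁ ≠ D₂ → ¬ D₁ ∪ D₂ ⊂ C₁ ∪ C₂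

/-- The set of all unions of subfamilies of `𝒮`, ordered by inclusion; the join is the union. -/
def unionLattice (𝒮 : Set (Set E)) : Set (Set E) := {B | ∃ T ⊆ 𝒮, B = ⋃₀ T}

/-- A finite family of elements of `𝒮` is modular if the height of its join in the lattice of
unions of elements of `𝒮` is the size of the family. -/
def IsModularFamily {ι : Type*} [Fintype ι] (𝒮 : Set (Set E)) (C : ι → Set E) : Prop :=
  (∀ i, C i ∈ 𝒮) ∧
    ∃ h : (⋃ i, C i) ∈ unionLattice 𝒮,
      Order.height (⟨⋃ i, C i, h⟩ : unionLattice 𝒮) = Fintype.card ι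

/-- The axioms common to weak and strong matroids: no zero vector, stability under nonzero
scalars, incomparability. -/
structure IsPreCircuitSet (C : Set (E → F)) : Prop where
  zero_notMem : (0 : E → F) ∉ C
  smul_mem : ∀ X ∈ C, ∀ a : F, a ≠ 0 → (fun e => a * X e) ∈ C
  incomparable : ∀ X ∈ C, ∀ Y ∈ C, Function.support X ⊆ Function.support Y →
    ∃ a : F, a ≠ 0 ∧ X = fun e => a * Y e

/-- `C` is the set of `F`-circuits of a weak `F`-matroid on `E`. -/
structure IsWeakCircuitSet (C : Set (E → F)) : Prop extends IsPreCircuitSet C where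
  modular_elimination : ∀ X ∈ C, ∀ Y ∈ C,
    IsModularPair (supports C) (Function.support X) (Function.support Y) →
    ∀ e : E, X e = -Y e → X e ≠ 0 →
      ∃ Z ∈ C, Z e = 0 ∧ ∀ f, Z f ∈ hadd (X f) (Y f)

/-- `C` is the set of `F`-circuits of a strong `F`-matroid on `E`. In the elimination axiom, the
family is `X = Xs 0` together with `Xᵢ = Xs i.succ` for `i : Fin k`. -/
structure IsStrongCircuitSet (C : Set (E → F)) : Prop extends IsPreCircuitSet C where
  strong_modular_elimination : ∀ (k : ℕ) (Xs : Fin (k + 1) → E → F), (∀ i, Xs i ∈ C) →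
    IsModularFamily (supports C) (fun i => Function.support (Xs i)) →
    ¬ Function.support (Xs 0) ⊆ ⋃ i : Fin k, Function.support (Xs i.succ) →
    ∀ e : Fin k → E,
      (∀ i, ∀ j, j ≠ i → Xs j.succ (e i) = 0) →
      (∀ i, Xs 0 (e i) = -Xs i.succ (e i) ∧ Xs 0 (e i) ≠ 0) →
      ∃ Z ∈ C, (∀ i, Z (e i) = 0) ∧ ∀ f, Z f ∈ hyperSumOver (fun i => Xs i f)

/-- `M` is the underlying matroid of an `F`-matroid on `E` with set of `F`-circuits `C`: its ground
set is all of `E`, and its circuits are the supports of the elements of `C`. -/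
def IsUnderlyingMatroid (M : Matroid E) (C : Set (E → F)) : Prop :=
  M.E = Set.univ ∧ ∀ S : Set E, M.IsCircuit S ↔ S ∈ supports C

theorem IsUnderlyingMatroid.unique {M N : Matroid E} {C : Set (E → F)}
    (hM : IsUnderlyingMatroid M C) (hN : IsUnderlyingMatroid N C) : M = N :=
  Matroid.ext_isCircuit (hM.1.trans hN.1.symm) fun S _ => (hM.2 S).trans (hN.2 S).symm

/-- The inner product of `X` and `Y` contains `0`. -/
def Orthogonal [Finite E] (τ : Involution F) (X Y : E → F) : Prop :=
  (0 : F) ∈ hyperSumOver (fun e => X e * τ.toFun (Y e))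

/-- The orthogonal complement of `C`. -/
def orthCompl [Finite E] (τ : Involution F) (C : Set (E → F)) : Set (E → F) :=
  {Y | ∀ X ∈ C, Orthogonal τ Y X}

/-- The vectors that are orthogonal to those elements of `C` whose support they meet in at most
three elements. -/
def weakOrthCompl [Finite E] (τ : Involution F) (C : Set (E → F)) : Set (E → F) :=
  {Y | ∀ X ∈ C, (Function.support X ∩ Function.support Y).ncard ≤ 3 → Orthogonal τ Y X}

/-- The `F`-circuits of the dual of a strong `F`-matroid with set of `F`-circuits `C`. -/
def strongDual [Finite E] (τ : Involution F) (C : Set (E → F)) : Set (E → F) :=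
  suppMin (orthCompl τ C \ {0})

/-- The `F`-circuits of the dual of a weak `F`-matroid with set of `F`-circuits `C`. For a weak
`F`-matroid, circuits and cocircuits are in general orthogonal only if their supports meet in at
most three elements. -/
def weakDual [Finite E] (τ : Involution F) (C : Set (E → F)) : Set (E → F) :=
  suppMin (weakOrthCompl τ C \ {0})

/-- The restriction of `X` to the complement of `A`. -/
def restr (A : Set E) (X : E → F) : ↥Aᶜ → F := fun e => X e

/-- `C \ A`: the restrictions of the elements of `C` whose support is disjoint from `A`. -/
def deletion (C : Set (E → F)) (A : Set E) : Set (↥Aᶜ → F) :=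
  restr A '' {X | X ∈ C ∧ Function.support X ∩ A = ∅}

/-- `C / A`: the nonzero restrictions of elements of `C` that have minimal support. -/
def contraction (C : Set (E → F)) (A : Set E) : Set (↥Aᶜ → F) :=
  suppMin (restr A '' C \ {0})

end

end HypMat

/-! The strong and the weak case are the values `⊤` and `3` of one parameter `N`. `ModularElim M C
N` is elimination for modular families of `k + 1` circuits with `k + 2 ≤ N`. `DualPair τ N M C D`
says that `C` and `D` are signatures of `M` and `M✶` whose members are orthogonal whenever their
supports meet in at most `N` elements. For `N ≥ 3` a signature satisfies elimination exactly when it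
is the first member of a dual pair (`exists_dualPair`, `DualPair.modularElim`). Dual pairs are
symmetric by definition, they pass to minors (`DualPair.deletion_contraction`), and the second
member is determined by the first as the vectors of minimal support in the bounded orthogonal
complement (`DualPair.suppMin_eq`). All claims on minors and duals follow.

Elimination and orthogonality are the same condition on a hypersum of `k + 2` terms: `z ∈ x₀ ⊞ ⋯ ⊞
xₖ` means `0 ∈ -z ⊞ x₀ ⊞ ⋯ ⊞ xₖ`. Given elimination, a base `B` and `f ∈ B` determine a vector on
the fundamental cocircuit of `f` by orthogonality to the fundamental circuits. It is orthogonal to a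
circuit vector `X` because all but one of the elements of `X` outside `B` can be eliminated with
fundamental circuits (`coVec_sum_of_elim`). Up to scaling it depends only on the cocircuit, since
bases can be joined by single exchanges, each of which needs `N ≥ 3`. Conversely, given a dual pair,
the eliminated vector lives on a fundamental circuit inside the union, and each of its remaining
entries is checked by pairing with one fundamental cocircuit.

The underlying matroid comes from extending elimination from modular pairs to all pairs of circuits.
The lattice height in (C3) and the modular pairs in (C3)' both become conditions on the nullity `|U|
- r(U)` (`height_unionLattice`). -/

namespace HypMat

open Hyperfield (hadd)

/-! ### Hyperfield arithmetic and finite hypersums. -/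

section HyperSum

variable {F : Type*} [Hyperfield F]

theorem hadd_zero (x : F) : hadd x 0 = {x} := by
  rw [Hyperfield.hadd_comm, Hyperfield.zero_hadd]

theorem hneg_zero : (-0 : F) = 0 :=
  (Hyperfield.eq_neg_of_zero_mem_hadd 0 0 (by simp [Hyperfield.zero_hadd])).symm

theorem hneg_hneg (x : F) : -(-x) = x :=
  (Hyperfield.eq_neg_of_zero_mem_hadd (-x) x
    (by rw [Hyperfield.hadd_comm]; exact Hyperfield.zero_mem_hadd_neg x)).symm

theorem mul_hneg (a x : F) : a * -x = -(a * x) := by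
  refine Hyperfield.eq_neg_of_zero_mem_hadd _ _ ?_
  rw [← Hyperfield.mul_hadd]
  exact ⟨0, Hyperfield.zero_mem_hadd_neg x, mul_zero a⟩

theorem hneg_mul (a x : F) : -a * x = -(a * x) := by
  rw [mul_comm, mul_hneg, mul_comm]

theorem hneg_eq_zero {x : F} : -x = 0 ↔ x = 0 := by
  refine ⟨fun h => ?_, fun h => by rw [h, hneg_zero]⟩
  rw [← hneg_hneg x, h, hneg_zero]

theorem zero_mem_hadd_iff {x y : F} : (0 : F) ∈ hadd x y ↔ y = -x :=
  ⟨Hyperfield.eq_neg_of_zero_mem_hadd x y, fun h => h ▸ Hyperfield.zero_mem_hadd_neg x⟩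

theorem hyperSum_zero : hyperSum (0 : Multiset F) = {0} := by
  simp [hyperSum]

theorem hyperSum_cons (x : F) (s : Multiset F) :
    hyperSum (x ::ₘ s) = haddSet x (hyperSum s) := by
  simp [hyperSum]

theorem haddSet_zero (S : Set F) : haddSet 0 S = S := by
  simp [haddSet, Hyperfield.zero_hadd]

theorem hyperSum_singleton (x : F) : hyperSum {x} = {x} := by
  rw [← Multiset.cons_zero, hyperSum_cons, hyperSum_zero]
  simp [haddSet, hadd_zero]

theorem hyperSum_pair (x y : F) : hyperSum {x, y} = hadd x y := by
  rw [Multiset.insert_eq_cons, hyperSum_cons, hyperSum_singleton]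
  simp [haddSet]

theorem mem_hyperSum_iff (z : F) (s : Multiset F) :
    z ∈ hyperSum s ↔ 0 ∈ hyperSum ((-z) ::ₘ s) := by
  rw [hyperSum_cons]
  simp only [haddSet, Set.mem_iUnion, exists_prop, zero_mem_hadd_iff, hneg_hneg]
  simp

theorem hyperSum_map_mul (a : F) (s : Multiset F) :
    hyperSum (s.map (a * ·)) = (a * ·) '' hyperSum s := by
  induction s using Multiset.induction with
  | empty => simp [hyperSum_zero]
  | cons x s ih =>
    rw [Multiset.map_cons, hyperSum_cons, hyperSum_cons, ih]
    simp only [haddSet, Set.image_iUnion, Hyperfield.mul_hadd, Set.biUnion_image]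

theorem hyperSum_map_involution (τ : Involution F) (s : Multiset F) :
    hyperSum (s.map τ.toFun) = τ.toFun '' hyperSum s := by
  induction s using Multiset.induction with
  | empty => simp [hyperSum_zero, τ.map_zero]
  | cons x s ih =>
    rw [Multiset.map_cons, hyperSum_cons, hyperSum_cons, ih]
    simp only [haddSet, Set.image_iUnion, τ.map_hadd, Set.biUnion_image]

theorem hyperSum_filter_ne_zero [DecidableEq F] (s : Multiset F) :
    hyperSum (s.filter fun x => x ≠ 0) = hyperSum s := by
  induction s using Multiset.induction with
  | empty => simp
  | cons x s ih =>
    by_cases hx : x = 0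
    · rw [Multiset.filter_cons_of_neg (p := fun x : F => x ≠ 0) s (not_not.2 hx), ih, hyperSum_cons, hx, haddSet_zero]
    · rw [Multiset.filter_cons_of_pos (p := fun x : F => x ≠ 0) s hx, hyperSum_cons, hyperSum_cons, ih]

variable {ι κ : Type*} [Finite ι] [Finite κ]

theorem hyperSumOver_eq_hyperSum [Fintype ι] (x : ι → F) :
    hyperSumOver x = hyperSum ((Finset.univ : Finset ι).val.map x) := by
  unfold hyperSumOver
  congr!

/-- Zero terms do not contribute to a hypersum. -/
theorem hyperSumOver_eq_of_injective {x : ι → F} {y : κ → F} (φ : ι → κ)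
    (hφ : Function.Injective φ) (h : ∀ i, y (φ i) = x i) (h0 : ∀ j, j ∉ Set.range φ → y j = 0) :
    hyperSumOver x = hyperSumOver y := by
  classical
  have := Fintype.ofFinite ι
  have := Fintype.ofFinite κ
  rw [hyperSumOver_eq_hyperSum, hyperSumOver_eq_hyperSum,
    ← hyperSum_filter_ne_zero ((Finset.univ : Finset κ).val.map y),
    ← hyperSum_filter_ne_zero ((Finset.univ : Finset ι).val.map x),
    Multiset.filter_map, Multiset.filter_map]
  have key : ((Finset.univ : Finset κ).filter ((fun t : F => t ≠ 0) ∘ y)) =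
      ((Finset.univ : Finset ι).filter ((fun t : F => t ≠ 0) ∘ x)).map ⟨φ, hφ⟩ := by
    ext j
    simp only [Finset.mem_filter, Finset.mem_univ, true_and, Function.comp_apply, Finset.mem_map,
      Function.Embedding.coeFn_mk]
    constructor
    · intro hj
      by_cases hr : j ∈ Set.range φ
      · obtain ⟨i, rfl⟩ := hr
        exact ⟨i, by rwa [← h i], rfl⟩
      · exact absurd (h0 j hr) hj
    · rintro ⟨i, hi, rfl⟩
      rwa [h i]
  have key' := congrArg Finset.val key
  simp only [Finset.filter_val, Finset.map_val] at key'
  rw [key', Multiset.map_map]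
  congr 1
  refine Multiset.map_congr rfl fun i _ => ?_
  exact (h i).symm

theorem hyperSumOver_eq_singleton {x : ι → F} (i : ι) (h : ∀ j, j ≠ i → x j = 0) :
    hyperSumOver x = {x i} := by
  rw [← hyperSumOver_eq_of_injective (x := fun _ : Unit => x i) (fun _ => i)
    (fun _ _ _ => rfl) (fun _ => rfl)
    (fun j hj => h j fun e => hj ⟨(), e.symm⟩), hyperSumOver_eq_hyperSum]
  simp [hyperSum_singleton]

theorem hyperSumOver_eq_zero {x : ι → F} (h : ∀ j, x j = 0) : hyperSumOver x = {0} := by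
  rw [← hyperSumOver_eq_of_injective (x := fun e : Empty => e.elim) (fun e => e.elim)
    (fun e => e.elim) (fun e => e.elim) (fun j _ => h j), hyperSumOver_eq_hyperSum]
  simp [hyperSum_zero]

theorem hyperSumOver_eq_hadd {x : ι → F} {i j : ι} (hij : i ≠ j)
    (h : ∀ l, l ≠ i → l ≠ j → x l = 0) : hyperSumOver x = hadd (x i) (x j) := by
  rw [← hyperSumOver_eq_of_injective (x := fun b : Fin 2 => x (![i, j] b)) ![i, j] ?_
    (fun _ => rfl) ?_, hyperSumOver_eq_hyperSum]
  · simp [Fin.univ_succ, ← hyperSum_pair]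
  · intro a b
    fin_cases a <;> fin_cases b <;> simp [hij, hij.symm]
  · intro l hl
    exact h l (fun e => hl ⟨0, e.symm⟩) (fun e => hl ⟨1, e.symm⟩)

/-- The bridge between elimination, which bounds an entry by a hypersum, and orthogonality, which
asks for a zero. It rests on the uniqueness of hyperinverses. -/
theorem mem_hyperSumOver_iff (z : F) (x : ι → F) :
    z ∈ hyperSumOver x ↔ 0 ∈ hyperSumOver (fun o : Option ι => o.elim (-z) x) := by
  have := Fintype.ofFinite ι
  rw [hyperSumOver_eq_hyperSum, hyperSumOver_eq_hyperSum, mem_hyperSum_iff]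
  simp [univ_option, Finset.insertNone]
  rfl

theorem hyperSumOver_mul (a : F) (x : ι → F) :
    hyperSumOver (fun i => a * x i) = (a * ·) '' hyperSumOver x := by
  have := Fintype.ofFinite ι
  rw [hyperSumOver_eq_hyperSum, hyperSumOver_eq_hyperSum, ← hyperSum_map_mul, Multiset.map_map]
  rfl

theorem zero_mem_hyperSumOver_mul_iff {a : F} (ha : a ≠ 0) (x : ι → F) :
    0 ∈ hyperSumOver (fun i => a * x i) ↔ 0 ∈ hyperSumOver x := by
  rw [hyperSumOver_mul]
  simp [ha]

theorem hyperSumOver_involution (τ : Involution F) (x : ι → F) :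
    hyperSumOver (fun i => τ.toFun (x i)) = τ.toFun '' hyperSumOver x := by
  have := Fintype.ofFinite ι
  rw [hyperSumOver_eq_hyperSum, hyperSumOver_eq_hyperSum, ← hyperSum_map_involution,
    Multiset.map_map]
  rfl

theorem Involution.eq_zero_iff (τ : Involution F) {x : F} : τ.toFun x = 0 ↔ x = 0 := by
  refine ⟨fun h => ?_, fun h => h ▸ τ.map_zero⟩
  rw [← τ.involutive x, h, τ.map_zero]

theorem Involution.injective (τ : Involution F) : Function.Injective τ.toFun :=
  Function.LeftInverse.injective τ.involutive

end HyperSum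

/-! ### Orthogonality of vectors with small common support. -/

section Orthogonal

variable {F E : Type*} [Hyperfield F] [Finite E] {τ : Involution F} {X Y : E → F}

/-- The involution preserves hypersums and fixes `0`, and applied termwise it exchanges the two
vectors. -/
theorem Orthogonal.symm (h : Orthogonal τ X Y) : Orthogonal τ Y X := by
  have h1 : (0 : F) ∈ hyperSumOver (fun e => τ.toFun (X e * τ.toFun (Y e))) := by
    rw [hyperSumOver_involution]
    exact ⟨0, h, τ.map_zero⟩
  have h2 : (fun e => τ.toFun (X e * τ.toFun (Y e))) = fun e => Y e * τ.toFun (X e) := by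
    funext e
    rw [τ.map_mul, τ.involutive, mul_comm]
  rwa [h2] at h1

theorem orthogonal_comm : Orthogonal τ X Y ↔ Orthogonal τ Y X :=
  ⟨Orthogonal.symm, Orthogonal.symm⟩

theorem orthogonal_smul_left {a : F} (ha : a ≠ 0) :
    Orthogonal τ (fun e => a * X e) Y ↔ Orthogonal τ X Y := by
  unfold Orthogonal
  simp only [mul_assoc]
  exact zero_mem_hyperSumOver_mul_iff ha _

theorem orthogonal_smul_right {a : F} (ha : a ≠ 0) :
    Orthogonal τ X (fun e => a * Y e) ↔ Orthogonal τ X Y := by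
  rw [orthogonal_comm, orthogonal_smul_left ha, orthogonal_comm]

/-- Two vectors whose supports meet inside `{e, f}` are orthogonal only if the two terms
cancel. -/
theorem Orthogonal.eq_neg_of_inter_subset_pair (h : Orthogonal τ X Y) {e f : E} (hef : e ≠ f)
    (hs : Function.support X ∩ Function.support Y ⊆ {e, f}) :
    X e * τ.toFun (Y e) = -(X f * τ.toFun (Y f)) := by
  unfold Orthogonal at h
  rw [hyperSumOver_eq_hadd hef.symm, zero_mem_hadd_iff] at h
  · exact h
  · intro l h1 h2
    by_contra hne
    have : l ∈ ({e, f} : Set E) := hs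
      ⟨left_ne_zero_of_mul hne, fun h0 => right_ne_zero_of_mul hne (by rw [h0, τ.map_zero])⟩
    rcases this with rfl | rfl
    · exact h2 rfl
    · exact h1 rfl

theorem Orthogonal.inter_ne_singleton (h : Orthogonal τ X Y) (e : E) :
    Function.support X ∩ Function.support Y ≠ {e} := by
  intro hs
  have he : e ∈ Function.support X ∩ Function.support Y := hs ▸ rfl
  unfold Orthogonal at h
  rw [hyperSumOver_eq_singleton e] at h
  · exact mul_ne_zero he.1 (fun h0 => he.2 (τ.eq_zero_iff.1 h0)) h.symm
  · intro l hl
    by_contra hne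
    have : l ∈ ({e} : Set E) := hs ▸
      ⟨left_ne_zero_of_mul hne, fun h0 => right_ne_zero_of_mul hne (by rw [h0, τ.map_zero])⟩
    exact hl this

theorem orthogonal_of_inter_eq_empty (hs : Function.support X ∩ Function.support Y = ∅) :
    Orthogonal τ X Y := by
  unfold Orthogonal
  rw [hyperSumOver_eq_zero]
  · rfl
  · intro l
    by_contra hne
    have : l ∈ (∅ : Set E) := hs ▸
      ⟨left_ne_zero_of_mul hne, fun h0 => right_ne_zero_of_mul hne (by rw [h0, τ.map_zero])⟩
    exact this

end Orthogonal

/-! ### From modular elimination to a matroid. -/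

section CircuitAxioms

variable {E : Type*} [Finite E]

/-- In a finite clutter, elimination for modular pairs implies elimination for all pairs. -/
theorem elimination_of_modular {𝒮 : Set (Set E)}
    (helim : ∀ C₁ C₂, IsModularPair 𝒮 C₁ C₂ → ∀ e ∈ C₁ ∩ C₂, ∃ D ∈ 𝒮, D ⊆ (C₁ ∪ C₂) \ {e}) :
    ∀ (n : ℕ), ∀ C₁ ∈ 𝒮, ∀ C₂ ∈ 𝒮, (C₁ ∪ C₂).ncard = n → C₁ ≠ C₂ → ∀ e ∈ C₁ ∩ C₂,
      ∃ D ∈ 𝒮, D ⊆ (C₁ ∪ C₂) \ {e} := by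
  intro n
  induction n using Nat.strong_induction_on with
  | _ n ih =>
    intro C₁ h₁ C₂ h₂ hn hne e he
    by_cases hmod : IsModularPair 𝒮 C₁ C₂
    · exact helim C₁ C₂ hmod e he
    -- A non-modular pair contains a pair with smaller union. Either one of its members already
    -- avoids `e`, or induction applies to it.
    · have : ∃ D₁ ∈ 𝒮, ∃ D₂ ∈ 𝒮, D₁ ≠ D₂ ∧ D₁ ∪ D₂ ⊂ C₁ ∪ C₂ := by
        by_contra! hcon
        exact hmod ⟨h₁, h₂, hne, fun D₁ hD₁ D₂ hD₂ hD => hcon D₁ hD₁ D₂ hD₂ hD⟩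
      obtain ⟨D₁, hD₁, D₂, hD₂, hD, hss⟩ := this
      by_cases he₁ : e ∈ D₁
      · by_cases he₂ : e ∈ D₂
        · obtain ⟨D, hDS, hDss⟩ := ih _ (hn ▸ Set.ncard_lt_ncard hss) D₁ hD₁ D₂ hD₂ rfl hD e
            ⟨he₁, he₂⟩
          exact ⟨D, hDS, hDss.trans (Set.sdiff_subset_sdiff_left hss.subset)⟩
        · exact ⟨D₂, hD₂, Set.subset_sdiff_singleton (Set.subset_union_right.trans hss.subset) he₂⟩
      · exact ⟨D₁, hD₁, Set.subset_sdiff_singleton (Set.subset_union_left.trans hss.subset) he₁⟩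

/-- A finite clutter of nonempty sets satisfying circuit elimination is the set of circuits of a
matroid. -/
theorem exists_matroid_of_elimination {𝒮 : Set (Set E)} (hempty : ∅ ∉ 𝒮)
    (hanti : ∀ C ∈ 𝒮, ∀ D ∈ 𝒮, C ⊆ D → C = D)
    (helim : ∀ C₁ ∈ 𝒮, ∀ C₂ ∈ 𝒮, C₁ ≠ C₂ → ∀ e ∈ C₁ ∩ C₂, ∃ D ∈ 𝒮, D ⊆ (C₁ ∪ C₂) \ {e}) :
    ∃ M : Matroid E, M.E = Set.univ ∧ ∀ S, M.IsCircuit S ↔ S ∈ 𝒮 := by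
  let Indep : Set E → Prop := fun I => ∀ C ∈ 𝒮, ¬ C ⊆ I
  have hsub : ∀ ⦃I J⦄, Indep J → I ⊆ J → Indep I := fun I J hJ hIJ C hC hCI =>
    hJ C hC (hCI.trans hIJ)
  have haug : ∀ ⦃I J⦄, Indep I → Indep J → I.ncard < J.ncard →
      ∃ e ∈ J, e ∉ I ∧ Indep (insert e I) := by
    intro I
    -- Induction on `|I \ J|`: exchanging an element of `J \ I` for one of `I \ J` keeps the size of
    -- `J` and brings it closer to `I`.
    suffices h : ∀ n, ∀ J, Indep I → Indep J → I.ncard < J.ncard → (I \ J).ncard = n →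
        ∃ e ∈ J, e ∉ I ∧ Indep (insert e I) from fun J hI hJ hlt => h _ J hI hJ hlt rfl
    intro n
    induction n using Nat.strong_induction_on with
    | _ n ih =>
      intro J hI hJ hlt hn
      by_cases hIJ : I ⊆ J
      · obtain ⟨e, heJ, heI⟩ : ∃ e ∈ J, e ∉ I := Set.exists_mem_notMem_of_ncard_lt_ncard hlt
        exact ⟨e, heJ, heI, hsub hJ (Set.insert_subset heJ hIJ)⟩
      obtain ⟨e, heI, heJ⟩ := Set.not_subset.1 hIJ
      -- either an exchange improves `J`, or elimination gives a contradiction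
      by_cases hex : ∃ f ∈ J \ I, Indep (insert e J \ {f})
      · obtain ⟨f, ⟨hfJ, hfI⟩, hind⟩ := hex
        have hef : e ≠ f := fun h => heJ (h ▸ hfJ)
        have hcard : (insert e J \ {f}).ncard = J.ncard := by
          rw [Set.ncard_sdiff_singleton_of_mem (Set.mem_insert_of_mem _ hfJ),
            Set.ncard_insert_of_notMem heJ]
          simp
        have hlt' : (I \ (insert e J \ {f})).ncard < n := by
          rw [← hn]
          refine Set.ncard_lt_ncard ⟨fun x hx => ⟨hx.1, fun hxJ => hx.2 ⟨Or.inr hxJ, ?_⟩⟩, ?_⟩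
          · rintro rfl
            exact hfI hx.1
          · intro hss
            exact (hss ⟨heI, heJ⟩).2 ⟨Or.inl rfl, hef⟩
        obtain ⟨g, hgJ, hgI, hg⟩ := ih _ hlt' _ hI hind (by rwa [hcard]) rfl
        refine ⟨g, ?_, hgI, hg⟩
        rcases hgJ.1 with rfl | h
        · exact absurd heI hgI
        · exact h
      · have hdep : ∀ f ∈ J \ I, ∃ C ∈ 𝒮, C ⊆ insert e J \ {f} ∧ e ∈ C := by
          intro f hf
          by_contra! hcon
          refine hex ⟨f, hf, fun C hC hCs => hJ C hC fun x hx => ?_⟩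
          rcases (hCs hx).1 with rfl | h
          · exact absurd hx (hcon C hC hCs)
          · exact h
        -- The second circuit is chosen to miss an element `h` of the first, so the two differ.
        -- Eliminating their common element `e` leaves a circuit inside `J`.
        obtain ⟨g, hgJ, hgI⟩ := Set.exists_mem_notMem_of_ncard_lt_ncard hlt
        obtain ⟨C₁, hC₁, hC₁s, heC₁⟩ := hdep g ⟨hgJ, hgI⟩
        obtain ⟨h, hhC, hhI⟩ : ∃ h ∈ C₁, h ∉ I := Set.not_subset.1 (hI C₁ hC₁)
        have hhJ : h ∈ J := by
          rcases (hC₁s hhC).1 with rfl | h'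
          · exact absurd heI hhI
          · exact h'
        obtain ⟨C₂, hC₂, hC₂s, heC₂⟩ := hdep h ⟨hhJ, hhI⟩
        have hne : C₁ ≠ C₂ := by
          rintro rfl
          exact (hC₂s hhC).2 rfl
        obtain ⟨D, hD, hDs⟩ := helim C₁ hC₁ C₂ hC₂ hne e ⟨heC₁, heC₂⟩
        refine absurd (fun x hx => ?_) (hJ D hD)
        obtain ⟨hx1 | hx1, hxe⟩ := hDs hx
        · exact (hC₁s hx1).1.resolve_left hxe
        · exact (hC₂s hx1).1.resolve_left hxe
  let N : IndepMatroid E := IndepMatroid.ofFinite (E := Set.univ) Set.finite_univ Indep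
    (fun C hC h => hempty (Set.subset_empty_iff.1 h ▸ hC)) hsub haug
    (fun _ _ => Set.subset_univ _)
  have hN : ∀ I, N.matroid.Indep I ↔ Indep I := fun I => by
    rw [IndepMatroid.matroid_Indep]; simp [N]
  have hE : N.matroid.E = Set.univ := by simp [N]
  refine ⟨N.matroid, hE, fun S => ?_⟩
  rw [Matroid.isCircuit_iff_minimal_not_indep (by rw [hE]; exact Set.subset_univ S)]
  simp only [hN, Indep]
  constructor
  · intro hmin
    have h1 := hmin.prop
    push Not at h1
    obtain ⟨C, hC, hCS⟩ := h1
    have : S ⊆ C := hmin.le_of_le (fun h => h C hC subset_rfl) hCS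
    rwa [this.antisymm hCS]
  · intro hS
    refine ⟨fun h => h S hS subset_rfl, fun T hT hTS => ?_⟩
    push Not at hT
    obtain ⟨C, hC, hCT⟩ := hT
    rw [hanti C hC S hS (hCT.trans hTS)] at hCT
    exact hCT

end CircuitAxioms

/-! ### Nullity, modular pairs and height in the lattice of unions of circuits. -/

section Nullity

variable {E : Type*} [Finite E] {M : Matroid E} {U V I : Set E}

/-- The number of elements of `U` outside a basis of `U`. -/
noncomputable def nullity (M : Matroid E) (U : Set E) : ℕ :=
  (U \ (M.exists_isBasis' U).choose).ncard

theorem nullity_eq_of_isBasis' (hI : M.IsBasis' I U) : nullity M U = (U \ I).ncard := by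
  have hJ := (M.exists_isBasis' U).choose_spec
  have h1 := hI.encard_eq_eRk.trans hJ.encard_eq_eRk.symm
  have h2 : I.ncard = (M.exists_isBasis' U).choose.ncard := by
    rw [Set.ncard_def, Set.ncard_def, h1]
  rw [nullity, Set.ncard_sdiff hJ.subset, Set.ncard_sdiff hI.subset, h2]

theorem nullity_mono (h : U ⊆ V) : nullity M U ≤ nullity M V := by
  obtain ⟨I, hI⟩ := M.exists_isBasis' U
  obtain ⟨J, hJ, hIJ⟩ := hI.indep.subset_isBasis'_of_subset (hI.subset.trans h)
  rw [nullity_eq_of_isBasis' hI, nullity_eq_of_isBasis' hJ]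
  refine Set.ncard_le_ncard fun x hx => ⟨h hx.1, fun hxJ => hx.2 ?_⟩
  exact hI.mem_of_insert_indep hx.1 (hJ.indep.subset (Set.insert_subset hxJ hIJ))

theorem nullity_sdiff_singleton_add_one {C : Set E} (hC : M.IsCircuit C) (hCU : C ⊆ U) {e : E}
    (he : e ∈ C) : nullity M (U \ {e}) + 1 = nullity M U := by
  obtain ⟨I, hI⟩ := M.exists_isBasis' (U \ {e})
  have heI : e ∉ I := fun h => (hI.subset h).2 rfl
  have hIU : M.IsBasis' I U := by
    rw [Matroid.isBasis'_iff_isBasis_closure]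
    refine ⟨?_, hI.subset.trans Set.sdiff_subset⟩
    have h1 := (Matroid.isBasis'_iff_isBasis_closure.1 hI).1
    have h2 : M.closure (U \ {e}) = M.closure U :=
      M.closure_sdiff_singleton_eq_closure (M.closure_subset_closure
        (Set.sdiff_subset_sdiff_left hCU) (hC.mem_closure_sdiff_singleton_of_mem he))
    rwa [← h2]
  rw [nullity_eq_of_isBasis' hI, nullity_eq_of_isBasis' hIU]
  have : U \ I = insert e ((U \ {e}) \ I) := by
    ext x
    by_cases hx : x = e
    · subst hx; simp [hCU he, heI]
    · simp [hx]
  rw [this, Set.ncard_insert_of_notMem (by simp)]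

theorem nullity_pos_of_isCircuit {C : Set E} (hC : M.IsCircuit C) (hCU : C ⊆ U) :
    0 < nullity M U := by
  obtain ⟨e, he⟩ := hC.nonempty
  have := nullity_sdiff_singleton_add_one hC hCU he
  omega

theorem exists_isCircuit_of_nullity_pos (hE : M.E = Set.univ) (h : 0 < nullity M U) :
    ∃ C ⊆ U, M.IsCircuit C := by
  by_contra! hcon
  have hind : M.Indep U := by
    rw [Matroid.indep_iff_forall_subset_not_isCircuit (by rw [hE]; exact Set.subset_univ U)]
    exact hcon
  rw [nullity_eq_of_isBasis' hind.isBasis_self.isBasis'] at h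
  simp at h

theorem two_le_nullity_union {C D : Set E} (hC : M.IsCircuit C) (hD : M.IsCircuit D)
    (hne : C ≠ D) : 2 ≤ nullity M (C ∪ D) := by
  obtain ⟨e, heC, heD⟩ : ∃ e ∈ C, e ∉ D :=
    Set.not_subset.1 fun h => hne (hC.eq_of_subset_isCircuit hD h)
  have h1 := nullity_sdiff_singleton_add_one hC (U := C ∪ D) Set.subset_union_left heC
  have h2 := nullity_pos_of_isCircuit hD (U := (C ∪ D) \ {e})
    (Set.subset_sdiff_singleton Set.subset_union_right heD)
  omega

/-- If the nullity were at least three, two distinct circuits would survive the removal of a point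
`e` of the union: one after deleting `e`, another after deleting also a point of the first. -/
theorem nullity_le_two_of_isModularPair (hE : M.E = Set.univ) {𝒮 : Set (Set E)}
    (h𝒮 : ∀ S, M.IsCircuit S ↔ S ∈ 𝒮) {C D : Set E} (h : IsModularPair 𝒮 C D) :
    nullity M (C ∪ D) ≤ 2 := by
  obtain ⟨hC, hD, hne, hmod⟩ := h
  by_contra! hlt
  obtain ⟨e, he⟩ := ((h𝒮 C).2 hC).nonempty
  have h1 := nullity_sdiff_singleton_add_one ((h𝒮 C).2 hC) (U := C ∪ D) Set.subset_union_left he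
  obtain ⟨C₁, hC₁s, hC₁⟩ := exists_isCircuit_of_nullity_pos (M := M) hE
    (U := (C ∪ D) \ {e}) (by omega)
  obtain ⟨f, hf⟩ := hC₁.nonempty
  have h2 := nullity_sdiff_singleton_add_one hC₁ hC₁s hf
  obtain ⟨C₂, hC₂s, hC₂⟩ := exists_isCircuit_of_nullity_pos (M := M) hE
    (U := ((C ∪ D) \ {e}) \ {f}) (by omega)
  refine hmod C₁ ((h𝒮 _).1 hC₁) C₂ ((h𝒮 _).1 hC₂) ?_ ⟨Set.union_subset
    (hC₁s.trans Set.sdiff_subset) ((hC₂s.trans Set.sdiff_subset).trans Set.sdiff_subset), ?_⟩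
  · rintro rfl
    exact (hC₂s hf).2 rfl
  · intro hss
    rcases hss (Or.inl he) with h' | h'
    · exact (hC₁s h').2 rfl
    · exact (hC₂s h').1.2 rfl

theorem isModularPair_of_nullity_le_two {𝒮 : Set (Set E)}
    (h𝒮 : ∀ S, M.IsCircuit S ↔ S ∈ 𝒮) {C D : Set E} (hC : C ∈ 𝒮) (hD : D ∈ 𝒮) (hne : C ≠ D)
    (h : nullity M (C ∪ D) ≤ 2) : IsModularPair 𝒮 C D := by
  refine ⟨hC, hD, hne, fun C₁ hC₁ C₂ hC₂ hne' hss => ?_⟩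
  obtain ⟨x, hx, hxn⟩ := Set.exists_of_ssubset hss
  have h1 := two_le_nullity_union ((h𝒮 _).2 hC₁) ((h𝒮 _).2 hC₂) hne'
  have h2 := nullity_mono (M := M) (Set.subset_sdiff_singleton hss.subset hxn)
  have h3 : nullity M ((C ∪ D) \ {x}) + 1 = nullity M (C ∪ D) := by
    rcases hx with hx | hx
    · exact nullity_sdiff_singleton_add_one ((h𝒮 _).2 hC) Set.subset_union_left hx
    · exact nullity_sdiff_singleton_add_one ((h𝒮 _).2 hD) Set.subset_union_right hx
  omega

/-- The union of the circuits inside `W` has the same nullity as `W`. -/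
theorem nullity_le_nullity_sUnion (hE : M.E = Set.univ) (W : Set E) :
    nullity M W ≤ nullity M (⋃₀ {C | M.IsCircuit C ∧ C ⊆ W}) := by
  have hss : ⋃₀ {C | M.IsCircuit C ∧ C ⊆ W} ⊆ W := Set.sUnion_subset fun C hC => hC.2
  obtain ⟨J, hJ⟩ := M.exists_isBasis' (⋃₀ {C | M.IsCircuit C ∧ C ⊆ W})
  obtain ⟨I, hI, hJI⟩ := hJ.indep.subset_isBasis'_of_subset (hJ.subset.trans hss)
  rw [nullity_eq_of_isBasis' hI, nullity_eq_of_isBasis' hJ]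
  refine Set.ncard_le_ncard fun x hx => ⟨?_, fun hxJ => hx.2 (hJI hxJ)⟩
  have hcl : x ∈ M.closure I := by
    rw [hI.closure_eq_closure]
    exact M.mem_closure_of_mem' hx.1 (by rw [hE]; trivial)
  exact ⟨M.fundCircuit x I, ⟨hI.indep.fundCircuit_isCircuit hcl hx.2,
    (M.fundCircuit_subset_insert x I).trans (Set.insert_subset hx.1 hI.subset)⟩,
    M.mem_fundCircuit x I⟩

theorem nullity_lt_of_lt {𝒮 : Set (Set E)} (h𝒮 : ∀ S, M.IsCircuit S ↔ S ∈ 𝒮)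
    {U V : unionLattice 𝒮} (h : V < U) : nullity M V.1 < nullity M U.1 := by
  have hss : V.1 ⊂ U.1 := h
  obtain ⟨x, hxU, hxV⟩ := Set.exists_of_ssubset hss
  obtain ⟨T, hT, hU⟩ := U.2
  rw [hU] at hxU
  obtain ⟨C, hCT, hxC⟩ := hxU
  have hCU : C ⊆ U.1 := hU ▸ Set.subset_sUnion_of_mem hCT
  have h1 := nullity_sdiff_singleton_add_one ((h𝒮 _).2 (hT hCT)) hCU hxC
  have h2 := nullity_mono (M := M) (Set.subset_sdiff_singleton hss.subset hxV)
  omega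

/-- The height in the lattice of unions of circuits is the nullity. -/
theorem height_unionLattice (hE : M.E = Set.univ) {𝒮 : Set (Set E)}
    (h𝒮 : ∀ S, M.IsCircuit S ↔ S ∈ 𝒮) (U : unionLattice 𝒮) :
    Order.height U = (nullity M U.1 : ℕ∞) := by
  apply le_antisymm
  · suffices h : ∀ n, ∀ U : unionLattice 𝒮, nullity M U.1 ≤ n → Order.height U ≤ (n : ℕ∞) from
      h _ U le_rfl
    intro n
    induction n using Nat.strong_induction_on with
    | _ n ih =>
      intro U hU
      rw [Order.height_le_coe_iff]
      intro V hV
      have hlt := nullity_lt_of_lt h𝒮 hV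
      exact (ih (nullity M V.1) (by omega) V le_rfl).trans_lt (by exact_mod_cast (by omega))
  · suffices h : ∀ n, ∀ U : unionLattice 𝒮, n ≤ nullity M U.1 → (n : ℕ∞) ≤ Order.height U from
      h _ U le_rfl
    intro n
    induction n with
    | zero => simp
    | succ n ih =>
      intro U hU
      obtain ⟨C, hCU, hC⟩ := exists_isCircuit_of_nullity_pos (M := M) hE (U := U.1) (by omega)
      obtain ⟨e, he⟩ := hC.nonempty
      have h1 := nullity_sdiff_singleton_add_one hC hCU he
      -- `U \ {e}` need not be a union of circuits. The union of the circuits inside it is, and has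
      -- the same nullity, one less than that of `U`.
      let V : unionLattice 𝒮 := ⟨⋃₀ {C | M.IsCircuit C ∧ C ⊆ U.1 \ {e}}, _,
        fun C hC => (h𝒮 C).1 hC.1, rfl⟩
      have hVU : V < U := by
        have hss : V.1 ⊆ U.1 \ {e} := Set.sUnion_subset fun C hC => hC.2
        exact ⟨hss.trans Set.sdiff_subset, fun h => (hss (h (hCU he))).2 rfl⟩
      have h2 : nullity M (U.1 \ {e}) ≤ nullity M V.1 := nullity_le_nullity_sUnion hE _
      have h3 := ih V (by omega)
      push_cast
      exact (add_le_add_left h3 1).trans (Order.height_add_one_le hVU)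

omit [Finite E] in
/-- A modular pair has height two in the lattice of unions. -/
theorem height_of_isModularPair {𝒮 : Set (Set E)} (hempty : ∅ ∉ 𝒮)
    (hanti : ∀ C ∈ 𝒮, ∀ D ∈ 𝒮, C ⊆ D → C = D) {C D : Set E} (h : IsModularPair 𝒮 C D)
    (hU : C ∪ D ∈ unionLattice 𝒮) : Order.height (⟨C ∪ D, hU⟩ : unionLattice 𝒮) = 2 := by
  obtain ⟨hC, hD, hne, hmod⟩ := h
  apply le_antisymm
  · have : (2 : ℕ∞) = ((2 : ℕ) : ℕ∞) := rfl
    rw [this, Order.height_le_coe_iff]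
    rintro V hV
    refine lt_of_le_of_lt (b := ((1 : ℕ) : ℕ∞)) ?_ (by norm_num)
    rw [Order.height_le_coe_iff]
    intro W hW
    have hWmin : IsMin W := by
      by_contra hmin
      have hWne : ¬ W.1 ⊆ ∅ := by
        intro h0
        refine hmin fun Y _ => ?_
        exact h0.trans (Set.empty_subset _)
      obtain ⟨x, hx⟩ := Set.nonempty_iff_ne_empty.2 fun h0 => hWne h0.subset
      obtain ⟨T, hT, hTW⟩ := W.2
      obtain ⟨T', hT', hTV⟩ := V.2
      rw [hTW] at hx
      obtain ⟨D₁, hD₁, hxD⟩ := hx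
      have hWV : W.1 ⊂ V.1 := hW
      obtain ⟨y, hyV, hyW⟩ := Set.exists_of_ssubset hWV
      rw [hTV] at hyV
      obtain ⟨D₂, hD₂, hyD⟩ := hyV
      have hD₁W : D₁ ⊆ W.1 := hTW ▸ Set.subset_sUnion_of_mem hD₁
      -- A nonempty `W` strictly below `V` gives a member inside `W` and another in `V` that leaves
      -- `W`. Their union lies in `V`, properly inside `C ∪ D`, against modularity.
      refine hmod D₁ (hT hD₁) D₂ (hT' hD₂) ?_ (lt_of_le_of_lt (b := V.1) ?_ hV)
      · rintro rfl
        exact hyW (hD₁W hyD)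
      · exact Set.union_subset (hD₁W.trans hWV.subset) (hTV ▸ Set.subset_sUnion_of_mem hD₂)
    rw [Order.height_eq_zero.2 hWmin]
    norm_num
  · let V : unionLattice 𝒮 := ⟨C, {C}, by simpa using hC, by simp⟩
    let W : unionLattice 𝒮 := ⟨∅, ∅, by simp, by simp⟩
    have h1 : W < V := ⟨Set.empty_subset _, fun h => hempty (Set.subset_empty_iff.1 h ▸ hC)⟩
    have h2 : V < ⟨C ∪ D, hU⟩ := by
      refine ⟨Set.subset_union_left, fun h => hne ?_⟩
      exact (hanti D hD C hC (Set.subset_union_right.trans h)).symm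
    calc (2 : ℕ∞) = 0 + 1 + 1 := by norm_num
      _ ≤ Order.height W + 1 + 1 := by gcongr; simp
      _ ≤ Order.height V + 1 := by gcongr; exact Order.height_add_one_le h1
      _ ≤ _ := Order.height_add_one_le h2

end Nullity

/-! ### Bases that meet a cocircuit in one element. -/

section Bases

variable {E : Type*} {M : Matroid E}

/-- The set `K \ {f}` is coindependent, so its complement spans and `I` extends to a base inside it.
That base cannot miss `K` altogether, because `K` is codependent. -/
theorem exists_isBase_inter_eq_singleton {K I : Set E} (hK : M.IsCocircuit K) {f : E} (hf : f ∈ K)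
    (hI : M.Indep I) (hIK : I ∩ K ⊆ {f}) : ∃ B, M.IsBase B ∧ I ⊆ B ∧ B ∩ K = {f} := by
  have hco : M.Coindep (K \ {f}) := hK.isCircuit.sdiff_singleton_indep hf
  obtain ⟨B, hB, hIB, hBs⟩ := hI.exists_isBase_subset_spanning hco.compl_spanning
    fun x hx => ⟨hI.subset_ground hx, fun h => h.2 (hIK ⟨hx, h.1⟩)⟩
  have hss : B ∩ K ⊆ {f} := fun x hx => by
    by_contra h
    exact (hBs hx.1).2 ⟨hx.2, h⟩
  refine ⟨B, hB, hIB, hss.antisymm ?_⟩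
  rintro _ rfl
  by_contra hn
  have hd : Disjoint K B := by
    rw [Set.disjoint_left]
    intro x hxK hxB
    have := hss ⟨hxB, hxK⟩
    rw [Set.mem_singleton_iff] at this
    subst this
    exact hn ⟨hxB, hxK⟩
  refine hK.isCircuit.not_indep (hB.compl_isBase_dual.indep.subset ?_)
  exact fun x hx => ⟨hK.subset_ground hx, hd.notMem_of_mem_left hx⟩

theorem fundCocircuit_eq_of_inter_eq {K B : Set E} (hK : M.IsCocircuit K) (hB : M.IsBase B) {f : E}
    (h : B ∩ K = {f}) : M.fundCocircuit f B = K := by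
  refine (hK.isCircuit.eq_fundCircuit_of_subset hB.compl_isBase_dual.indep fun x hx => ?_).symm
  by_cases hxB : x ∈ B
  · exact Or.inl (h ▸ ⟨hxB, hx⟩ : x ∈ ({f} : Set E))
  · exact Or.inr ⟨hK.subset_ground hx, hxB⟩

end Bases

/-! ### Signatures, and the cocircuit vectors attached to a base. -/

section Signature

variable {F E : Type*} [Hyperfield F] {M : Matroid E} {C D : Set (E → F)}
  {τ : Involution F} {N : ℕ∞}

theorem support_smul {a : F} (ha : a ≠ 0) (X : E → F) :
    Function.support (fun e => a * X e) = Function.support X := by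
  ext e; simp [ha]

/-- `C` is an `F`-signature of the matroid `M`. -/
structure IsSignature (M : Matroid E) (C : Set (E → F)) : Prop where
  pre : IsPreCircuitSet C
  underlying : IsUnderlyingMatroid M C

theorem IsPreCircuitSet.empty_notMem (h : IsPreCircuitSet C) : ∅ ∉ supports C := by
  rintro ⟨X, hX, h0⟩
  rw [Function.support_eq_empty_iff] at h0
  exact h.zero_notMem (h0 ▸ hX)

theorem IsPreCircuitSet.eq_of_subset (h : IsPreCircuitSet C) :
    ∀ S ∈ supports C, ∀ T ∈ supports C, S ⊆ T → S = T := by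
  rintro _ ⟨X, hX, rfl⟩ _ ⟨Y, hY, rfl⟩ hXY
  obtain ⟨a, ha, rfl⟩ := h.incomparable X hX Y hY hXY
  exact support_smul ha Y

namespace IsSignature

theorem mem_ground (h : IsSignature M C) (e : E) : e ∈ M.E := by
  rw [h.underlying.1]; trivial

theorem subset_ground (h : IsSignature M C) (S : Set E) : S ⊆ M.E := by
  rw [h.underlying.1]; exact Set.subset_univ S

theorem isCircuit (h : IsSignature M C) {X : E → F} (hX : X ∈ C) :
    M.IsCircuit (Function.support X) := (h.underlying.2 _).2 ⟨X, hX, rfl⟩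

theorem exists_of_isCircuit (h : IsSignature M C) {S : Set E} (hS : M.IsCircuit S) {e : E}
    (he : e ∈ S) {a : F} (ha : a ≠ 0) : ∃ X ∈ C, Function.support X = S ∧ X e = a := by
  obtain ⟨X, hX, rfl⟩ := (h.underlying.2 _).1 hS
  have hXe : X e ≠ 0 := he
  have hb : a * (X e)⁻¹ ≠ 0 := mul_ne_zero ha (inv_ne_zero hXe)
  refine ⟨_, h.pre.smul_mem X hX _ hb, support_smul hb X, ?_⟩
  simp [hXe]

theorem apply_ne_zero_of_subset_insert (h : IsSignature M C) {B : Set E} (hB : M.Indep B) {e : E}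
    {X : E → F} (hX : X ∈ C) (hXB : Function.support X ⊆ insert e B) : X e ≠ 0 := by
  intro h0
  refine (h.isCircuit hX).not_indep (hB.subset fun x hx => (hXB hx).resolve_left ?_)
  rintro rfl
  exact hx h0

theorem smul_eq_of_subset_insert (h : IsSignature M C) {B : Set E} (hB : M.Indep B) {e : E}
    {X Y : E → F} (hX : X ∈ C) (hY : Y ∈ C) (hXB : Function.support X ⊆ insert e B)
    (hYB : Function.support Y ⊆ insert e B) : ∃ a : F, a ≠ 0 ∧ X = fun e => a * Y e := by
  refine h.pre.incomparable X hX Y hY ?_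
  rw [(h.isCircuit hX).eq_fundCircuit_of_subset hB hXB,
    (h.isCircuit hY).eq_fundCircuit_of_subset hB hYB]

end IsSignature

open Classical in
/-- For a base `B` of the underlying matroid and `f ∈ B`, the vector supported on the fundamental
cocircuit of `f` that is orthogonal to all fundamental circuits of `B`. -/
noncomputable def coVec (C : Set (E → F)) (B : Set E) (f : E) : E → F := fun e =>
  if e ∈ B then (if e = f then 1 else 0)
  -- The value solves `Z e * c = -Z f`. For independent `B` it does not depend on `Z`, as circuit
  -- vectors inside `insert e B` are proportional. For a base of the underlying matroid the last
  -- default never occurs.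
  else if h : ∃ Z ∈ C, Function.support Z ⊆ insert e B then -(h.choose f * (h.choose e)⁻¹) else 0

theorem coVec_self {B : Set E} {f : E} (hf : f ∈ B) : coVec C B f f = 1 := by
  simp [coVec, hf]

theorem coVec_of_mem {B : Set E} {f e : E} (he : e ∈ B) (hne : e ≠ f) : coVec C B f e = 0 := by
  simp [coVec, he, hne]

/-- A fundamental circuit is orthogonal to the vector `coVec C B f`. -/
theorem IsSignature.mul_coVec (h : IsSignature M C) {B : Set E} (hB : M.Indep B) {e f : E}
    (he : e ∉ B) {X : E → F} (hX : X ∈ C) (hXB : Function.support X ⊆ insert e B) :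
    X e * coVec C B f e = -X f := by
  have hex : ∃ Z ∈ C, Function.support Z ⊆ insert e B := ⟨X, hX, hXB⟩
  obtain ⟨hZ, hZB⟩ := hex.choose_spec
  have hZe := h.apply_ne_zero_of_subset_insert hB hZ hZB
  obtain ⟨a, ha, hXa⟩ := h.smul_eq_of_subset_insert hB hX hZ hXB hZB
  have hval : coVec C B f e = -(hex.choose f * (hex.choose e)⁻¹) := by
    simp only [coVec, he, if_false, dif_pos hex]
  rw [hval, mul_hneg]
  have h1 : X e = a * hex.choose e := congrFun hXa e
  have h2 : X f = a * hex.choose f := congrFun hXa f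
  rw [h1, h2]
  congr 1
  rw [mul_comm (hex.choose f), mul_assoc, mul_inv_cancel_left₀ hZe]

theorem IsSignature.support_coVec (h : IsSignature M C) {B : Set E} (hB : M.IsBase B) {f : E}
    (hf : f ∈ B) : Function.support (coVec C B f) = M.fundCocircuit f B := by
  ext e
  by_cases heB : e ∈ B
  · have h1 : e ∈ M.fundCocircuit f B ↔ e = f := by
      have h2 := M.fundCocircuit_inter_eq hf
      rw [← Set.mem_singleton_iff, ← h2]
      simp [heB]
    rw [h1]
    simp [coVec, heB]
  · have hcirc := hB.fundCircuit_isCircuit (h.mem_ground e) heB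
    obtain ⟨X, hX, hXs⟩ := (h.underlying.2 _).1 hcirc
    have hXB : Function.support X ⊆ insert e B := hXs ▸ M.fundCircuit_subset_insert e B
    have hXe := h.apply_ne_zero_of_subset_insert hB.indep hX hXB
    have hmul := h.mul_coVec hB.indep (f := f) heB hX hXB
    rw [hB.mem_fundCocircuit_iff_mem_fundCircuit, ← hXs, Function.mem_support, Function.mem_support,
      ← not_iff_not, not_not, not_not, ← hneg_eq_zero (x := X f), ← hmul]
    simp [hXe]

/-- Modular elimination for families of at most `N - 1` circuits, in terms of the nullity. -/
def ModularElim (M : Matroid E) (C : Set (E → F)) (N : ℕ∞) : Prop :=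
  ∀ (k : ℕ), ((k + 2 : ℕ) : ℕ∞) ≤ N → ∀ Xs : Fin (k + 1) → E → F, (∀ i, Xs i ∈ C) →
    nullity M (⋃ i, Function.support (Xs i)) ≤ k + 1 →
    ¬ Function.support (Xs 0) ⊆ ⋃ i : Fin k, Function.support (Xs i.succ) →
    ∀ e : Fin k → E,
      (∀ i, ∀ j, j ≠ i → Xs j.succ (e i) = 0) →
      (∀ i, Xs 0 (e i) = -Xs i.succ (e i) ∧ Xs 0 (e i) ≠ 0) →
      ∃ Z ∈ C, (∀ i, Z (e i) = 0) ∧ ∀ f, Z f ∈ hyperSumOver (fun i => Xs i f)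

/-- Places the `k + 2` terms of a hypersum `-z ⊞ x₀ ⊞ ⋯ ⊞ xₖ` at distinct points of `E`: `-z` at
`g`, `x₀` at `f`, and `xᵢ` at the `i`-th eliminated element. -/
theorem injective_elim_cons {k : ℕ} {g f : E} {e : Fin k → E} (hfg : f ≠ g)
    (he : Function.Injective e) (hf : ∀ i, e i ≠ f) (hg : ∀ i, e i ≠ g) :
    Function.Injective fun o : Option (Fin (k + 1)) => o.elim g (Fin.cons f e) := by
  have hcons : Function.Injective (Fin.cons f e : Fin (k + 1) → E) :=
    Fin.cons_injective_iff.2 ⟨fun ⟨i, hi⟩ => hf i hi, he⟩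
  have hg' : ∀ i, (Fin.cons f e : Fin (k + 1) → E) i ≠ g := fun i => by
    refine Fin.cases ?_ (fun i => ?_) i
    · exact hfg
    · exact hg i
  rintro (_ | a) (_ | b) hab
  · rfl
  · exact absurd hab.symm (hg' b)
  · exact absurd hab (hg' a)
  · exact congrArg some (hcons hab)

variable [Finite E]

/-- Let `e₀, …, eₖ` be the elements of `X` outside `B`. Eliminating `e₁, …, eₖ` from `X` with
fundamental circuits leaves a vector `Y` on the fundamental circuit of `e₀`, and its membership
condition at `f` is the required sum. There are `k + 1` circuits involved, whence the bound with `+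
1`. -/
theorem coVec_sum_of_elim (h : IsSignature M C) (hN : ModularElim M C N) {B : Set E}
    (hB : M.IsBase B) {f : E} (hf : f ∈ B) {X : E → F} (hX : X ∈ C)
    (hXN : (Function.support X \ B).encard + 1 ≤ N) :
    0 ∈ hyperSumOver (fun e => X e * coVec C B f e) := by
  have hfin : (Function.support X \ B).Finite := Set.toFinite _
  obtain ⟨k, hk⟩ : ∃ k, (Function.support X \ B).ncard = k + 1 := by
    refine Nat.exists_eq_succ_of_ne_zero fun h0 => ?_
    rw [Set.ncard_eq_zero, Set.sdiff_eq_empty] at h0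
    exact (h.isCircuit hX).not_indep (hB.indep.subset h0)
  have hk' : ((k + 2 : ℕ) : ℕ∞) ≤ N := by
    rw [← hfin.cast_ncard_eq, hk] at hXN
    exact_mod_cast hXN
  have : Fintype ↥(Function.support X \ B) := Fintype.ofFinite _
  have hcard : Fintype.card ↥(Function.support X \ B) = k + 1 := by
    rw [← Nat.card_eq_fintype_card, ← hk]; rfl
  let eq := (Fintype.equivFinOfCardEq hcard).symm
  let e : Fin (k + 1) → E := fun i => eq i
  have he_inj : Function.Injective e := Subtype.val_injective.comp eq.injective
  have heX : ∀ i, X (e i) ≠ 0 := fun i => (eq i).2.1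
  have heB : ∀ i, e i ∉ B := fun i => (eq i).2.2
  have he_surj : ∀ x, X x ≠ 0 → x ∉ B → ∃ i, e i = x := fun x hx hxB =>
    ⟨eq.symm ⟨x, hx, hxB⟩, by simp [e]⟩
  have hZ : ∀ i : Fin k, ∃ Z ∈ C, Function.support Z = M.fundCircuit (e i.succ) B ∧
      Z (e i.succ) = -X (e i.succ) := fun i =>
    h.exists_of_isCircuit (hB.fundCircuit_isCircuit (h.mem_ground _) (heB _))
      (M.mem_fundCircuit _ _) (fun h0 => heX _ (hneg_eq_zero.1 h0))
  choose Z hZC hZs hZe using hZ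
  have hZB : ∀ i, Function.support (Z i) ⊆ insert (e i.succ) B := fun i =>
    hZs i ▸ M.fundCircuit_subset_insert _ _
  have hZ0 : ∀ i x, x ∉ B → x ≠ e i.succ → Z i x = 0 := by
    intro i x hxB hxe
    by_contra hne
    exact (hZB i hne).elim hxe hxB
  let Xs : Fin (k + 1) → E → F := Fin.cons X Z
  have hXs0 : Xs 0 = X := rfl
  have hXsS : ∀ i : Fin k, Xs i.succ = Z i := fun i => rfl
  have hXsC : ∀ i, Xs i ∈ C := by
    intro i
    refine Fin.cases ?_ (fun i => ?_) i
    · exact hX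
    · exact hZC i
  have hUss : (⋃ i, Function.support (Xs i)) ⊆ B ∪ Function.support X := by
    refine Set.iUnion_subset fun i => ?_
    refine Fin.cases ?_ (fun i => ?_) i
    · exact Set.subset_union_right
    · intro x hx
      rcases hZB i hx with rfl | hx
      · exact Or.inr (heX _)
      · exact Or.inl hx
  -- The union lies in `B ∪ support X`, of which `B` is a basis with complement `{e₀, …, eₖ}`.
  have hnull : nullity M (⋃ i, Function.support (Xs i)) ≤ k + 1 := by
    refine (nullity_mono hUss).trans ?_
    have hb : M.IsBasis' B (B ∪ Function.support X) :=
      (hB.indep.isBasis_of_subset_of_subset_closure Set.subset_union_left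
        (by rw [hB.closure_eq]; exact h.subset_ground _)).isBasis'
    rw [nullity_eq_of_isBasis' hb, Set.union_sdiff_left, hk]
  have hne : ¬ Function.support (Xs 0) ⊆ ⋃ i : Fin k, Function.support (Xs i.succ) := by
    intro hss
    obtain ⟨i, hi⟩ := Set.mem_iUnion.1 (hss (heX 0))
    exact hi (hZ0 i _ (heB 0) (he_inj.ne (Fin.succ_ne_zero i).symm))
  obtain ⟨Y, hYC, hYe, hY⟩ := hN k hk' Xs hXsC hnull hne (fun i => e i.succ)
    (fun i j hji => hZ0 j _ (heB _) (he_inj.ne fun h' => hji (Fin.succ_injective _ h').symm))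
    (fun i => ⟨by rw [hXs0, hXsS, hZe, hneg_hneg], heX _⟩)
  have hYe0 : Y (e 0) = X (e 0) := by
    have := hY (e 0)
    rw [hyperSumOver_eq_singleton 0] at this
    · exact this
    · intro j hj
      obtain ⟨j, rfl⟩ := Fin.exists_succ_eq.2 hj
      exact hZ0 j _ (heB 0) (he_inj.ne (Fin.succ_ne_zero j).symm)
  have hYB : Function.support Y ⊆ insert (e 0) B := by
    intro x hx
    by_contra hcon
    rw [Set.mem_insert_iff, not_or] at hcon
    have hXx : X x = 0 := by
      by_contra hXx
      obtain ⟨i, rfl⟩ := he_surj x hXx hcon.2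
      revert hx hcon
      refine Fin.cases ?_ (fun i => ?_) i
      · intro _ h'; exact h'.1 rfl
      · intro h' _; exact h' (hYe i)
    have hYx := hY x
    rw [hyperSumOver_eq_zero] at hYx
    · exact hx hYx
    · intro j
      refine Fin.cases ?_ (fun j => ?_) j
      · exact hXx
      · refine hZ0 j x hcon.2 ?_
        rintro rfl
        exact heX _ hXx
  have hmem := hY f
  rw [mem_hyperSumOver_iff] at hmem
  let φ : Option (Fin (k + 1)) → E := fun o =>
    o.elim (e 0) (Fin.cons f fun i : Fin k => e i.succ)
  have hfe : ∀ i, f ≠ e i := fun i h' => heB i (h' ▸ hf)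
  have hφ : Function.Injective φ := injective_elim_cons (hfe 0)
    (he_inj.comp (Fin.succ_injective k)) (fun i => (hfe _).symm)
    (fun i => he_inj.ne (Fin.succ_ne_zero i))
  rwa [hyperSumOver_eq_of_injective φ hφ (y := fun e => X e * coVec C B f e)] at hmem
  · rintro (_ | i)
    · change X (e 0) * coVec C B f (e 0) = -Y f
      rw [← hYe0, h.mul_coVec hB.indep (heB 0) hYC hYB]
    · refine Fin.cases ?_ (fun i => ?_) i
      · change X f * coVec C B f f = X f
        rw [coVec_self hf, mul_one]
      · change X (e i.succ) * coVec C B f (e i.succ) = Z i f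
        rw [← hneg_hneg (X (e i.succ)), ← hZe, hneg_mul,
          h.mul_coVec hB.indep (heB _) (hZC i) (hZB i), hneg_hneg]
  · intro x hx
    by_cases hxB : x ∈ B
    · rw [coVec_of_mem hxB, mul_zero]
      rintro rfl
      exact hx ⟨some 0, rfl⟩
    · by_cases hXx : X x = 0
      · rw [hXx, zero_mul]
      · obtain ⟨i, rfl⟩ := he_surj x hXx hxB
        exfalso
        revert hx
        refine Fin.cases ?_ (fun i => ?_) i
        · exact fun h' => h' ⟨none, rfl⟩
        · exact fun h' => h' ⟨some i.succ, rfl⟩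

end Signature

/-! ### Construction of the dual signature from elimination. -/

section DualExistence

variable {F E : Type*} [Hyperfield F] [Finite E] {M : Matroid E} {C D : Set (E → F)}
  {τ : Involution F} {N : ℕ∞}

/-- `C` and `D` are signatures of `M` and of its dual, and their elements are orthogonal whenever
their supports meet in at most `N` elements. -/
structure DualPair (τ : Involution F) (N : ℕ∞) (M : Matroid E) (C D : Set (E → F)) : Prop where
  left : IsSignature M C
  right : IsSignature M✶ D
  orth : ∀ X ∈ C, ∀ Y ∈ D, (Function.support X ∩ Function.support Y).encard ≤ N →
    Orthogonal τ X Y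

theorem DualPair.symm (h : DualPair τ N M C D) : DualPair τ N M✶ D C where
  left := h.right
  right := by rw [M.dual_dual]; exact h.left
  orth X hX Y hY hXY := (h.orth Y hY X hX (by rwa [Set.inter_comm])).symm

/-- The fundamental circuit of `e ∈ K` over `B'` meets `K` only inside `{e, f'}`, so orthogonality
to it fixes the ratio of the entries at `e` and `f'` for both vectors. That circuit has at most two
elements outside `B`, which is where `3 ≤ N` comes from. -/
theorem coVec_eq_of_sdiff_le_one (h : IsSignature M C) (hN : ModularElim M C N) (hN3 : 3 ≤ N)
    {K : Set E} (hK : M.IsCocircuit K) {B B' : Set E} (hB : M.IsBase B) (hB' : M.IsBase B')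
    {f f' : E} (hf : B ∩ K = {f}) (hf' : B' ∩ K = {f'}) (hBB' : (B' \ B).encard ≤ 1) :
    coVec C B f = fun e => coVec C B f f' * coVec C B' f' e := by
  have hfm : f ∈ B ∩ K := hf ▸ rfl
  have hfm' : f' ∈ B' ∩ K := hf' ▸ rfl
  have hs := (h.support_coVec hB hfm.1).trans (fundCocircuit_eq_of_inter_eq hK hB hf)
  have hs' := (h.support_coVec hB' hfm'.1).trans (fundCocircuit_eq_of_inter_eq hK hB' hf')
  funext e
  by_cases heK : e ∈ K
  · by_cases hef : e = f'
    · rw [hef, coVec_self hfm'.1, mul_one]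
    have heB' : e ∉ B' := fun he => hef (hf' ▸ ⟨he, heK⟩ : e ∈ ({f'} : Set E))
    obtain ⟨X, hX, hXs⟩ := (h.underlying.2 _).1 (hB'.fundCircuit_isCircuit (h.mem_ground e) heB')
    have hXB : Function.support X ⊆ insert e B' := hXs ▸ M.fundCircuit_subset_insert e B'
    have hXe := h.apply_ne_zero_of_subset_insert hB'.indep hX hXB
    have hcard : (Function.support X \ B).encard + 1 ≤ N := by
      have h1 : Function.support X \ B ⊆ insert e (B' \ B) := fun x hx =>
        (hXB hx.1).imp id fun h' => ⟨h', hx.2⟩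
      calc (Function.support X \ B).encard + 1
          ≤ (insert e (B' \ B)).encard + 1 := by gcongr
        _ ≤ ((B' \ B).encard + 1) + 1 := by gcongr; exact Set.encard_insert_le _ _
        _ ≤ (1 + 1) + 1 := by gcongr
        _ ≤ N := by norm_num; exact hN3
    have hsum := coVec_sum_of_elim h hN hB hfm.1 hX hcard
    rw [hyperSumOver_eq_hadd (Ne.symm hef), zero_mem_hadd_iff] at hsum
    · have h1 := h.mul_coVec hB'.indep (f := f') heB' hX hXB
      refine mul_left_cancel₀ hXe ?_
      rw [hsum, mul_left_comm, h1, mul_hneg, mul_comm]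
    · intro l hlf hle
      by_contra hne
      have hlK : l ∈ K := hs ▸ right_ne_zero_of_mul hne
      rcases hXB (left_ne_zero_of_mul hne) with hl | hl
      · exact hle hl
      · exact hlf (hf' ▸ ⟨hl, hlK⟩ : l ∈ ({f'} : Set E))
  · have h1 : coVec C B f e = 0 := by
      by_contra hne
      exact heK (hs ▸ hne)
    have h2 : coVec C B' f' e = 0 := by
      by_contra hne
      exact heK (hs' ▸ hne)
    rw [h1, h2, mul_zero]

omit [Finite E] in
theorem inter_nonempty_of_isCocircuit {K B : Set E} (hK : M.IsCocircuit K) (hB : M.IsBase B) :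
    (B ∩ K).Nonempty := by
  by_contra hn
  rw [Set.not_nonempty_iff_eq_empty] at hn
  refine hK.isCircuit.not_indep (hB.compl_isBase_dual.indep.subset fun x hx =>
    ⟨hK.subset_ground hx, fun hxB => ?_⟩)
  exact (hn ▸ ⟨hxB, hx⟩ : x ∈ (∅ : Set E))

/-- Up to scaling, `coVec C B f` depends only on the fundamental cocircuit of `f` and `B`. -/
theorem exists_coVec_eq_smul (h : IsSignature M C) (hN : ModularElim M C N) (hN3 : 3 ≤ N)
    {K : Set E} (hK : M.IsCocircuit K) {B' : Set E} (hB' : M.IsBase B') {f' : E}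
    (hf' : B' ∩ K = {f'}) (n : ℕ) : ∀ B f, M.IsBase B → B ∩ K = {f} → (B' \ B).ncard = n →
    ∃ c : F, c ≠ 0 ∧ coVec C B f = fun e => c * coVec C B' f' e := by
  have hfm' : f' ∈ B' ∩ K := hf' ▸ rfl
  have hstep : ∀ B₁ f₁ B₂ f₂, M.IsBase B₁ → M.IsBase B₂ → B₁ ∩ K = {f₁} → B₂ ∩ K = {f₂} →
      (B₂ \ B₁).encard ≤ 1 → ∃ c : F, c ≠ 0 ∧ coVec C B₁ f₁ = fun e => c * coVec C B₂ f₂ e := by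
    intro B₁ f₁ B₂ f₂ h₁ h₂ hf₁ hf₂ hle
    refine ⟨_, ?_, coVec_eq_of_sdiff_le_one h hN hN3 hK h₁ h₂ hf₁ hf₂ hle⟩
    have hm₁ : f₁ ∈ B₁ ∩ K := hf₁ ▸ rfl
    have hm₂ : f₂ ∈ B₂ ∩ K := hf₂ ▸ rfl
    rw [← Function.mem_support, h.support_coVec h₁ hm₁.1, fundCocircuit_eq_of_inter_eq hK h₁ hf₁]
    exact hm₂.2
  induction n using Nat.strong_induction_on with
  | _ n ih =>
    intro B f hB hf hn
    have hfm : f ∈ B ∩ K := hf ▸ rfl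
    by_cases hle : (B' \ B).encard ≤ 1
    · exact hstep B f B' f' hB hB' hf hf' hle
    have hne : (B \ B').Nonempty := by
      by_contra hemp
      rw [Set.not_nonempty_iff_eq_empty, Set.sdiff_eq_empty] at hemp
      refine hle ?_
      rw [hB.eq_of_subset_isBase hB' hemp]
      simp
    suffices hex : ∃ B₁ f₁, M.IsBase B₁ ∧ B₁ ∩ K = {f₁} ∧ (B₁ \ B).encard ≤ 1 ∧
        (B' \ B₁).ncard < n by
      obtain ⟨B₁, f₁, hB₁, hf₁, hle₁, hlt⟩ := hex
      obtain ⟨c, hc, hcB⟩ := ih _ hlt B₁ f₁ hB₁ hf₁ rfl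
      obtain ⟨d, hd, hdB⟩ := hstep B f B₁ f₁ hB hB₁ hf hf₁ hle₁
      refine ⟨d * c, mul_ne_zero hd hc, ?_⟩
      rw [hdB, hcB]
      simp only [mul_assoc]
    have hexch : ∀ b ∈ B \ B', ∃ y ∈ B' \ B, M.IsBase (insert y (B \ {b})) ∧
        (insert y (B \ {b}) \ B).encard ≤ 1 ∧ (B' \ insert y (B \ {b})).ncard < n := by
      intro b hb
      obtain ⟨y, hy, hyB⟩ := hB.exchange hB' hb
      refine ⟨y, hy, hyB, ?_, ?_⟩
      · refine (Set.encard_le_encard (t := {y}) ?_).trans (by simp)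
        intro x hx
        exact hx.1.resolve_right fun h' => hx.2 h'.1
      · rw [← hn]
        refine Set.ncard_lt_ncard ⟨fun x hx => ⟨hx.1, fun hxB => hx.2 (Or.inr ⟨hxB, ?_⟩)⟩, ?_⟩
        · rintro rfl
          exact hb.2 hx.1
        · exact fun hss => (hss hy).2 (Or.inl rfl)
    -- The intermediate base must still meet `K` in one element. If `f ∈ B'`, then `f = f'` and the
    -- element brought in from `B'` avoids `K`; otherwise `f` itself is exchanged.
    by_cases hfB' : f ∈ B'
    · obtain ⟨b, hb⟩ := hne
      obtain ⟨y, hy, hyB, hle₁, hlt⟩ := hexch b hb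
      refine ⟨_, f, hyB, ?_, hle₁, hlt⟩
      have hff' : f = f' := (hf' ▸ ⟨hfB', hfm.2⟩ : f ∈ ({f'} : Set E))
      have hyK : y ∉ K := fun hyK => by
        have : y = f' := (hf' ▸ ⟨hy.1, hyK⟩ : y ∈ ({f'} : Set E))
        exact hy.2 (this ▸ hff' ▸ hfm.1)
      ext x
      constructor
      · rintro ⟨rfl | hx, hxK⟩
        · exact absurd hxK hyK
        · exact hf ▸ ⟨hx.1, hxK⟩
      · rintro rfl
        refine ⟨Or.inr ⟨hfm.1, ?_⟩, hfm.2⟩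
        rintro rfl
        exact hb.2 hfB'
    · obtain ⟨y, hy, hyB, hle₁, hlt⟩ := hexch f ⟨hfm.1, hfB'⟩
      refine ⟨_, y, hyB, ?_, hle₁, hlt⟩
      have hss : insert y (B \ {f}) ∩ K ⊆ {y} := by
        rintro x ⟨rfl | hx, hxK⟩
        · rfl
        · exact absurd (hf ▸ ⟨hx.1, hxK⟩ : x ∈ ({f} : Set E)) hx.2
      exact (Set.Nonempty.subset_singleton_iff (inter_nonempty_of_isCocircuit hK hyB)).1 hss

/-- The dual consists of all nonzero multiples of conjugated vectors `coVec C B f`. To test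
orthogonality to `X`, the base may be changed to one adapted to `X`. -/
theorem exists_dualPair (τ : Involution F) (h : IsSignature M C) (hN : ModularElim M C N)
    (hN3 : 3 ≤ N) : ∃ D, DualPair τ N M C D := by
  let D : Set (E → F) := {Y | ∃ a : F, a ≠ 0 ∧ ∃ B f, M.IsBase B ∧ f ∈ B ∧
    Y = fun e => a * τ.toFun (coVec C B f e)}
  have hsτ : ∀ W : E → F, Function.support (fun e => τ.toFun (W e)) = Function.support W := by
    intro W
    ext e
    simp [τ.eq_zero_iff]
  have hsupp : ∀ (a : F) (B : Set E) (f : E), a ≠ 0 → M.IsBase B → f ∈ B →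
      Function.support (fun e => a * τ.toFun (coVec C B f e)) = M.fundCocircuit f B := by
    intro a B f ha hB hf
    rw [support_smul ha (fun e => τ.toFun (coVec C B f e)), hsτ, h.support_coVec hB hf]
  have hcoc : ∀ K, M.IsCocircuit K → ∀ f ∈ K, ∀ I, M.Indep I → I ∩ K ⊆ {f} →
      ∃ B, M.IsBase B ∧ I ⊆ B ∧ B ∩ K = {f} ∧ f ∈ B ∧ M.fundCocircuit f B = K := by
    intro K hK f hf I hI hIK
    obtain ⟨B, hB, hIB, hBK⟩ := exists_isBase_inter_eq_singleton hK hf hI hIK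
    exact ⟨B, hB, hIB, hBK, (hBK ▸ rfl : f ∈ B ∩ K).1, fundCocircuit_eq_of_inter_eq hK hB hBK⟩
  have hprop : ∀ B f B' f', M.IsBase B → f ∈ B → M.IsBase B' → f' ∈ B' →
      M.fundCocircuit f B = M.fundCocircuit f' B' →
      ∃ c : F, c ≠ 0 ∧ coVec C B f = fun e => c * coVec C B' f' e := by
    intro B f B' f' hB hf hB' hf' heq
    have h1 := M.fundCocircuit_inter_eq hf
    have h2 := M.fundCocircuit_inter_eq hf'
    rw [Set.inter_comm] at h1 h2
    rw [heq] at h1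
    exact exists_coVec_eq_smul h hN hN3 (Matroid.fundCocircuit_isCocircuit hf' hB') hB' h2 _ B f
      hB h1 rfl
  refine ⟨D, h, ⟨⟨?_, ?_, ?_⟩, ?_, ?_⟩, ?_⟩
  · rintro ⟨a, ha, B, f, hB, hf, h0⟩
    have := congrFun h0 f
    simp only [coVec_self hf, τ.map_one, mul_one, Pi.zero_apply] at this
    exact ha this.symm
  · rintro _ ⟨a, ha, B, f, hB, hf, rfl⟩ b hb
    exact ⟨b * a, mul_ne_zero hb ha, B, f, hB, hf, by simp only [mul_assoc]⟩
  · rintro _ ⟨a, ha, B, f, hB, hf, rfl⟩ _ ⟨b, hb, B', f', hB', hf', rfl⟩ hss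
    rw [hsupp a B f ha hB hf, hsupp b B' f' hb hB' hf'] at hss
    obtain ⟨c, hc, hcB⟩ := hprop B f B' f' hB hf hB' hf'
      ((Matroid.fundCocircuit_isCocircuit hf hB).isCircuit.eq_of_subset_isCircuit
        (Matroid.fundCocircuit_isCocircuit hf' hB').isCircuit hss)
    refine ⟨a * τ.toFun c * b⁻¹, mul_ne_zero (mul_ne_zero ha fun h0 => hc (τ.eq_zero_iff.1 h0))
      (inv_ne_zero hb), ?_⟩
    funext e
    rw [hcB, τ.map_mul, mul_assoc _ b⁻¹, inv_mul_cancel_left₀ hb, mul_assoc]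
  · exact h.underlying.1
  · intro S
    constructor
    · intro hS
      have hS' : M.IsCocircuit S := hS
      obtain ⟨f, hf⟩ := hS'.nonempty
      obtain ⟨B, hB, -, -, hfB, hfund⟩ := hcoc S hS' f hf ∅ M.empty_indep (by simp)
      refine ⟨_, ⟨1, one_ne_zero, B, f, hB, hfB, rfl⟩, ?_⟩
      rw [hsupp 1 B f one_ne_zero hB hfB, hfund]
    · rintro ⟨_, ⟨a, ha, B, f, hB, hf, rfl⟩, rfl⟩
      rw [hsupp a B f ha hB hf]
      exact Matroid.fundCocircuit_isCocircuit hf hB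
  · rintro X hX _ ⟨a, ha, B', f', hB', hf', rfl⟩ hle
    rw [orthogonal_smul_right ha]
    rw [hsupp a B' f' ha hB' hf'] at hle
    set K := M.fundCocircuit f' B' with hKdef
    have hK : M.IsCocircuit K := Matroid.fundCocircuit_isCocircuit hf' hB'
    by_cases hemp : Function.support X ∩ K = ∅
    · refine orthogonal_of_inter_eq_empty ?_
      rw [hsτ, h.support_coVec hB' hf', ← hKdef, hemp]
    obtain ⟨f, hf⟩ := Set.nonempty_iff_ne_empty.2 hemp
    have hXc := h.isCircuit hX
    obtain ⟨g, hg, hgf⟩ := (hXc.isCocircuit_inter_nontrivial hK ⟨f, hf⟩).exists_ne f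
    -- A circuit and a cocircuit that meet do so in at least two elements, so this is a proper
    -- subset of a circuit. A base containing it and meeting `K` only in `f` gives `|X \ B| + 1 ≤ |X
    -- ∩ K| ≤ N`.
    have hI : M.Indep (Function.support X \ (K \ {f})) :=
      hXc.ssubset_indep (Set.sdiff_subset.ssubset_of_mem_notMem hg.1 fun h' => h'.2 ⟨hg.2, hgf⟩)
    obtain ⟨B, hB, hIB, hBK, hfB, hfund⟩ := hcoc K hK f hf.2 _ hI (by
      rintro x ⟨⟨_, hx⟩, hxK⟩
      by_contra hne
      exact hx ⟨hxK, hne⟩)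
    have hXB : Function.support X \ B ⊆ (Function.support X ∩ K) \ {f} := by
      rintro x ⟨hx, hxB⟩
      have : x ∈ K \ {f} := by
        by_contra hcon
        exact hxB (hIB ⟨hx, hcon⟩)
      exact ⟨⟨hx, this.1⟩, this.2⟩
    have hle' : (Function.support X \ B).encard + 1 ≤ N := by
      refine le_trans ?_ hle
      rw [← Set.encard_sdiff_singleton_add_one hf]
      gcongr
    have hsum := coVec_sum_of_elim h hN hB hfB hX hle'
    obtain ⟨c, hc, hcB⟩ := hprop B' f' B f hB' hf' hB hfB hfund.symm
    unfold Orthogonal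
    simp only [τ.involutive, hcB]
    simp only [mul_left_comm _ c]
    rwa [zero_mem_hyperSumOver_mul_iff hc]

end DualExistence

/-! ### From orthogonality back to elimination; the strong and weak axioms in terms of `N`. -/

section Elimination

variable {F E : Type*} [Hyperfield F] [Finite E] {M : Matroid E} {C D : Set (E → F)}
  {τ : Involution F} {N : ℕ∞}

/-- In the situation of modular elimination, the elements to be eliminated together with one
element `g` private to the first circuit form the complement of a spanning subset of the union. -/
theorem elim_nullity (h : IsSignature M C) {k : ℕ} {Xs : Fin (k + 1) → E → F}
    (hXs : ∀ i, Xs i ∈ C) {g : E} (hg0 : Xs 0 g ≠ 0) (hgs : ∀ i : Fin k, Xs i.succ g = 0)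
    {e : Fin k → E} (he : ∀ i, ∀ j, j ≠ i → Xs j.succ (e i) = 0)
    (he' : ∀ i, Xs 0 (e i) = -Xs i.succ (e i) ∧ Xs 0 (e i) ≠ 0) :
    k + 1 ≤ nullity M (⋃ i, Function.support (Xs i)) ∧
      (nullity M (⋃ i, Function.support (Xs i)) ≤ k + 1 →
        M.IsBasis ((⋃ i, Function.support (Xs i)) \ insert g (Set.range e))
          (⋃ i, Function.support (Xs i))) := by
  set U := ⋃ i, Function.support (Xs i) with hU
  set S := insert g (Set.range e) with hS
  have hsub : ∀ i, Function.support (Xs i) ⊆ U := fun i =>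
    Set.subset_iUnion (fun i => Function.support (Xs i)) i
  have hes : ∀ i, Xs i.succ (e i) ≠ 0 := fun i h0 => by
    have := he' i
    rw [h0, hneg_zero] at this
    exact this.2 this.1
  have hinj : Function.Injective e := fun i j hij => by
    by_contra hne
    exact hes j (hij ▸ he i j (Ne.symm hne))
  have hSU : S ⊆ U := by
    rintro x (rfl | ⟨i, rfl⟩)
    · exact hsub 0 hg0
    · exact hsub 0 (he' i).2
  have hScard : S.ncard = k + 1 := by
    rw [hS, Set.ncard_insert_of_notMem, ← Set.image_univ, Set.ncard_image_of_injective _ hinj,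
      Set.ncard_univ, Nat.card_fin]
    rintro ⟨i, hi⟩
    exact hes i (hi ▸ hgs i)
  have hecl : ∀ i, e i ∈ M.closure (U \ S) := by
    intro i
    refine M.closure_subset_closure ?_
      ((h.isCircuit (hXs i.succ)).mem_closure_sdiff_singleton_of_mem (hes i))
    rintro x ⟨hx, hxe⟩
    refine ⟨hsub _ hx, ?_⟩
    rintro (rfl | ⟨j, rfl⟩)
    · exact hx (hgs i)
    · by_cases hij : i = j
      · exact hxe (hij ▸ rfl)
      · exact hx (he j i hij)
  -- Each `e i` is spanned through its own circuit, which avoids `g` and the other `e j`. Then `g`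
  -- is spanned through the circuit of `Xs 0`.
  have hUcl : U ⊆ M.closure (U \ S) := by
    have hne : ∀ x ∈ U, x ≠ g → x ∈ M.closure (U \ S) := by
      intro x hx hxg
      by_cases hxe : x ∈ Set.range e
      · obtain ⟨i, rfl⟩ := hxe
        exact hecl i
      · exact M.mem_closure_of_mem' ⟨hx, fun h' => h'.elim hxg hxe⟩ (h.mem_ground x)
    intro x hx
    by_cases hxg : x = g
    · subst hxg
      rw [← M.closure_closure]
      refine M.closure_subset_closure ?_
        ((h.isCircuit (hXs 0)).mem_closure_sdiff_singleton_of_mem hg0)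
      exact fun y hy => hne y (hsub 0 hy.1) hy.2
    · exact hne x hx hxg
  obtain ⟨I, hI⟩ := M.exists_isBasis (U \ S) (h.subset_ground _)
  have hIU : M.IsBasis I U := hI.indep.isBasis_of_subset_of_subset_closure
    (hI.subset.trans Set.sdiff_subset) (hI.closure_eq_closure ▸ hUcl)
  have hSI : S ⊆ U \ I := fun x hx => ⟨hSU hx, fun hxI => (hI.subset hxI).2 hx⟩
  rw [nullity_eq_of_isBasis' hIU.isBasis', ← hScard]
  refine ⟨Set.ncard_le_ncard hSI, fun hle => ?_⟩
  have hSeq := Set.eq_of_subset_of_ncard_le hSI hle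
  rw [hSeq, Set.sdiff_sdiff_cancel_left hIU.subset]
  exact hIU

/-- `Z` must avoid every `e i`, so it is sought on the fundamental circuit of `g` over the basis `K`
of the union, scaled to agree with `Xs 0` at `g`. For `f ∈ K`, a cocircuit vector `W` meeting the
union only in `f`, `g` and the `e i` turns its orthogonality to `Xs 0` into the condition on `Z f`.
-/
theorem DualPair.modularElim (h : DualPair τ N M C D) : ModularElim M C N := by
  intro k hk Xs hXs hnull hne e he he'
  obtain ⟨g, hg0, hgs⟩ := Set.not_subset.1 hne
  replace hgs : ∀ i : Fin k, Xs i.succ g = 0 := fun i => by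
    by_contra h0
    exact hgs (Set.mem_iUnion.2 ⟨i, h0⟩)
  have hbas := (elim_nullity h.left hXs hg0 hgs he he').2 hnull
  set U := ⋃ i, Function.support (Xs i) with hU
  set K := U \ insert g (Set.range e) with hK
  have hsub : ∀ i, Function.support (Xs i) ⊆ U := fun i =>
    Set.subset_iUnion (fun i => Function.support (Xs i)) i
  have hes : ∀ i, Xs i.succ (e i) ≠ 0 := fun i h0 => by
    have := he' i
    rw [h0, hneg_zero] at this
    exact this.2 this.1
  have hinj : Function.Injective e := fun i j hij => by
    by_contra hne
    exact hes j (hij ▸ he i j (Ne.symm hne))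
  have hge : ∀ i, e i ≠ g := fun i hi => hes i (hi ▸ hgs i)
  have hgK : g ∉ K := fun hx => hx.2 (Or.inl rfl)
  have heK : ∀ i, e i ∉ K := fun i hx => hx.2 (Or.inr ⟨i, rfl⟩)
  have hKc : M.IsCircuit (M.fundCircuit g K) :=
    hbas.indep.fundCircuit_isCircuit (hbas.subset_closure (hsub 0 hg0)) hgK
  obtain ⟨Z, hZ, hZs, hZg⟩ := h.left.exists_of_isCircuit hKc (M.mem_fundCircuit g K) hg0
  have hZK : Function.support Z ⊆ insert g K := hZs ▸ M.fundCircuit_subset_insert g K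
  have hZe : ∀ i, Z (e i) = 0 := fun i => by
    by_contra h0
    exact (hZK h0).elim (hge i) (heK i)
  refine ⟨Z, hZ, hZe, fun f => ?_⟩
  by_cases hfU : f ∉ U
  · have hX0 : ∀ i, Xs i f = 0 := fun i => by
      by_contra h0
      exact hfU (hsub i h0)
    rw [hyperSumOver_eq_zero hX0, Set.mem_singleton_iff]
    by_contra h0
    rcases hZK h0 with rfl | h'
    · exact hfU (hsub 0 hg0)
    · exact hfU h'.1
  rw [not_not] at hfU
  by_cases hfg : f = g
  · subst hfg
    rw [hyperSumOver_eq_singleton 0, hZg]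
    · rfl
    · intro j hj
      obtain ⟨j, rfl⟩ := Fin.exists_succ_eq.2 hj
      exact hgs j
  by_cases hfe : f ∈ Set.range e
  · obtain ⟨i, rfl⟩ := hfe
    rw [hyperSumOver_eq_hadd (Fin.succ_ne_zero i).symm, hZe i, zero_mem_hadd_iff, (he' i).1,
      hneg_hneg]
    intro l hl0 hli
    obtain ⟨l, rfl⟩ := Fin.exists_succ_eq.2 hl0
    exact he i l fun h' => hli (h' ▸ rfl)
  have hfK : f ∈ K := ⟨hfU, fun h' => h'.elim hfg hfe⟩
  obtain ⟨B, hB, hKB⟩ := hbas.indep.exists_isBase_superset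
  have hcoc : M.IsCocircuit (M.fundCocircuit f B) :=
    Matroid.fundCocircuit_isCocircuit (hKB hfK) hB
  obtain ⟨W, hW, hWs, hWf⟩ := h.right.exists_of_isCircuit hcoc.isCircuit
    (M.mem_fundCocircuit f B) (one_ne_zero (α := F))
  have hWU : ∀ x ∈ U, W x ≠ 0 → x = f ∨ x = g ∨ x ∈ Set.range e := by
    intro x hxU hx
    have hx' : x ∈ insert f (M.E \ B) := M.fundCocircuit_subset_insert_compl f B (hWs ▸ hx)
    refine hx'.imp id fun h' => ?_
    by_contra hcon
    exact h'.2 (hKB ⟨hxU, hcon⟩)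
  have hZU : Function.support Z ⊆ U := hZK.trans
    (Set.insert_subset (hsub 0 hg0) Set.sdiff_subset)
  have hN2 : (2 : ℕ∞) ≤ N := le_trans (by exact_mod_cast (by omega : 2 ≤ k + 2)) hk
  have hpair : ∀ x y : E, ∀ X ∈ C, x ≠ y →
      Function.support X ∩ Function.support W ⊆ {x, y} →
      X x * τ.toFun (W x) = -(X y * τ.toFun (W y)) := by
    intro x y X hX hxy hss
    refine (h.orth X hX W hW (le_trans ?_ hN2)).eq_neg_of_inter_subset_pair hxy hss
    refine (Set.encard_le_encard hss).trans ((Set.encard_insert_le _ _).trans ?_)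
    rw [Set.encard_singleton]
    norm_num
  -- Orthogonality of `W` to `Z` and to each `Xs i.succ` involves two terms only, and expresses the
  -- terms of `Xs 0` against `W` at `g` and `e i` through `Z f` and `Xs i.succ f`.
  have h1 : Z g * τ.toFun (W g) = -(Z f * τ.toFun (W f)) := by
    refine hpair g f Z hZ (Ne.symm hfg) ?_
    rintro x ⟨hx, hxW⟩
    rcases hWU x (hZU hx) hxW with rfl | rfl | ⟨i, rfl⟩
    · exact Or.inr rfl
    · exact Or.inl rfl
    · exact absurd (hZe i) hx
  have h2 : ∀ i : Fin k, Xs 0 (e i) * τ.toFun (W (e i)) = Xs i.succ f * τ.toFun (W f) := by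
    intro i
    rw [(he' i).1, hneg_mul, hpair (e i) f (Xs i.succ) (hXs _) (fun h' => hfe ⟨i, h'⟩), hneg_hneg]
    rintro x ⟨hx, hxW⟩
    rcases hWU x (hsub _ hx) hxW with rfl | rfl | ⟨j, rfl⟩
    · exact Or.inr rfl
    · exact absurd (hgs i) hx
    · refine Or.inl ?_
      by_contra hne
      exact hx (he j i fun h' => hne (h' ▸ rfl))
  have hφ := injective_elim_cons (g := g) (f := f) hfg hinj
    (fun i h' => hfe ⟨i, h'⟩) hge
  -- The supports meet within the `k + 2` elements `g`, `f`, `e i`; this is the only use of the full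
  -- bound `k + 2 ≤ N`.
  have horth : Orthogonal τ (Xs 0) W := by
    refine h.orth _ (hXs 0) W hW (le_trans ?_ hk)
    have hss : Function.support (Xs 0) ∩ Function.support W ⊆
        Set.range fun o : Option (Fin (k + 1)) => (o.elim g (Fin.cons f e) : E) := by
      rintro x ⟨hx, hxW⟩
      rcases hWU x (hsub _ hx) hxW with rfl | rfl | ⟨j, rfl⟩
      · exact ⟨some 0, rfl⟩
      · exact ⟨none, rfl⟩
      · exact ⟨some j.succ, rfl⟩
    refine (Set.encard_le_encard hss).trans ?_
    rw [← Set.image_univ, hφ.encard_image, Set.encard_univ]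
    simp
    exact le_of_eq (by ring)
  unfold Orthogonal at horth
  rw [← hyperSumOver_eq_of_injective
    (x := fun o : Option (Fin (k + 1)) => τ.toFun (W f) * o.elim (-Z f) fun i => Xs i f)
    _ hφ, zero_mem_hyperSumOver_mul_iff, ← mem_hyperSumOver_iff] at horth
  · exact horth
  · rw [hWf, τ.map_one]
    exact one_ne_zero
  · rintro (_ | i)
    · change Xs 0 g * τ.toFun (W g) = τ.toFun (W f) * -Z f
      rw [← hZg, h1, mul_hneg, mul_comm]
    · refine Fin.cases ?_ (fun i => ?_) i
      · exact mul_comm _ _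
      · change Xs 0 (e i) * τ.toFun (W (e i)) = τ.toFun (W f) * Xs i.succ f
        rw [h2, mul_comm]
  · intro x hx
    by_contra h0
    have hX := left_ne_zero_of_mul h0
    have hWx : W x ≠ 0 := fun h' => right_ne_zero_of_mul h0 (by rw [h', τ.map_zero])
    rcases hWU x (hsub 0 hX) hWx with rfl | rfl | ⟨j, rfl⟩
    · exact hx ⟨some 0, rfl⟩
    · exact hx ⟨none, rfl⟩
    · exact hx ⟨some j.succ, rfl⟩

/-- Height equals nullity, and under the elimination hypotheses the nullity is at least `k + 1`, so
the bound in `ModularElim` is an equality. -/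
theorem IsSignature.isStrongCircuitSet_iff (h : IsSignature M C) :
    IsStrongCircuitSet C ↔ ModularElim M C ⊤ := by
  constructor
  · intro hC k _ Xs hXs hnull hne e he he'
    refine hC.strong_modular_elimination k Xs hXs ⟨fun i => ⟨_, hXs i, rfl⟩, ⟨⟨_, ?_, rfl⟩, ?_⟩⟩
      hne e he he'
    · rintro _ ⟨i, rfl⟩
      exact ⟨_, hXs i, rfl⟩
    · rw [height_unionLattice h.underlying.1 h.underlying.2]
      obtain ⟨g, hg0, hgs⟩ := Set.not_subset.1 hne
      have hlow := (elim_nullity h hXs hg0 (fun i => by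
        by_contra h0
        exact hgs (Set.mem_iUnion.2 ⟨i, h0⟩)) he he').1
      rw [Fintype.card_fin]
      exact_mod_cast le_antisymm hnull hlow
  · intro hN
    refine { h.pre with strong_modular_elimination := ?_ }
    intro k Xs hXs hmod hne e he he'
    refine hN k le_top Xs hXs ?_ hne e he he'
    obtain ⟨-, hmem, hh⟩ := hmod
    rw [height_unionLattice h.underlying.1 h.underlying.2, Fintype.card_fin] at hh
    exact_mod_cast hh.le

theorem iUnion_fin_two {α : Type*} (S : Fin 2 → Set α) : ⋃ i, S i = S 0 ∪ S 1 := by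
  ext x
  simp [Fin.exists_fin_two]

/-- The bound `k + 2 ≤ 3` leaves `k = 0`, where `Xs 0` itself is the answer, and `k = 1`, which is
elimination for modular pairs. -/
theorem IsSignature.isWeakCircuitSet_iff (h : IsSignature M C) :
    IsWeakCircuitSet C ↔ ModularElim M C 3 := by
  have h𝒮 := h.underlying.2
  constructor
  · intro hC k hk Xs hXs hnull hne e he he'
    have hk1 : k ≤ 1 := by
      have : k + 2 ≤ 3 := by exact_mod_cast hk
      omega
    interval_cases k
    · refine ⟨Xs 0, hXs 0, fun i => i.elim0, fun f => ?_⟩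
      rw [hyperSumOver_eq_singleton 0 fun j hj => absurd (Fin.fin_one_eq_zero j) hj]
      rfl
    · rw [iUnion_fin_two] at hnull
      have hne' : Function.support (Xs 0) ≠ Function.support (Xs 1) := fun h' =>
        hne (h' ▸ Set.subset_iUnion (fun i : Fin 1 => Function.support (Xs i.succ)) 0)
      obtain ⟨Z, hZ, hZe, hZf⟩ := hC.modular_elimination (Xs 0) (hXs 0) (Xs 1) (hXs 1)
        (isModularPair_of_nullity_le_two h𝒮 ⟨_, hXs 0, rfl⟩ ⟨_, hXs 1, rfl⟩ hne' hnull)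
        (e 0) (he' 0).1 (he' 0).2
      refine ⟨Z, hZ, fun i => by rw [Subsingleton.elim i 0, hZe], fun f => ?_⟩
      rw [hyperSumOver_eq_hadd (i := (0 : Fin 2)) (j := 1) (by decide)]
      · exact hZf f
      · intro l h0 h1
        fin_cases l
        · exact absurd rfl h0
        · exact absurd rfl h1
  · intro hN
    refine { h.pre with modular_elimination := ?_ }
    intro X hX Y hY hmod e hXY hXe
    have hnull := nullity_le_two_of_isModularPair h.underlying.1 h𝒮 hmod
    obtain ⟨Z, hZ, hZe, hZf⟩ := hN 1 (by norm_num) ![X, Y]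
      (fun i => by fin_cases i <;> assumption)
      (by rw [iUnion_fin_two]; exact hnull)
      (by
        intro hss
        refine hmod.2.2.1 (h.pre.eq_of_subset _ ⟨X, hX, rfl⟩ _ ⟨Y, hY, rfl⟩ ?_)
        intro x hx
        obtain ⟨i, hi⟩ := Set.mem_iUnion.1 (hss hx)
        rw [Subsingleton.elim i 0] at hi
        exact hi)
      (fun _ => e) (fun i j hij => absurd (Subsingleton.elim j i) hij)
      (fun i => by rw [Subsingleton.elim i 0]; exact ⟨hXY, hXe⟩)
    refine ⟨Z, hZ, hZe 0, fun f => ?_⟩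
    have := hZf f
    rw [hyperSumOver_eq_hadd (i := (0 : Fin 2)) (j := 1) (by decide)] at this
    · exact this
    · intro l h0 h1
      fin_cases l
      · exact absurd rfl h0
      · exact absurd rfl h1

theorem IsWeakCircuitSet.exists_isSignature (h : IsWeakCircuitSet C) :
    ∃ M : Matroid E, IsSignature M C := by
  suffices helim : ∀ C₁ C₂, IsModularPair (supports C) C₁ C₂ → ∀ e ∈ C₁ ∩ C₂,
      ∃ D ∈ supports C, D ⊆ (C₁ ∪ C₂) \ {e} by
    obtain ⟨M, hE, hM⟩ := exists_matroid_of_elimination h.toIsPreCircuitSet.empty_notMem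
      h.toIsPreCircuitSet.eq_of_subset fun C₁ h₁ C₂ h₂ hne e he =>
        elimination_of_modular helim _ C₁ h₁ C₂ h₂ rfl hne e he
    exact ⟨M, h.toIsPreCircuitSet, hE, hM⟩
  rintro _ _ hmod e ⟨heX, heY⟩
  obtain ⟨⟨X, hX, rfl⟩, ⟨Y, hY, rfl⟩, -⟩ := id hmod
  have hYe : Y e ≠ 0 := heY
  -- `Y` is rescaled so that its entry at `e` becomes `-X e`.
  have hb : -X e * (Y e)⁻¹ ≠ 0 :=
    mul_ne_zero (fun h0 => heX (hneg_eq_zero.1 h0)) (inv_ne_zero hYe)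
  rw [← support_smul hb Y] at hmod
  obtain ⟨Z, hZ, hZe, hZf⟩ := h.modular_elimination X hX _ (h.smul_mem Y hY _ hb) hmod e
    (by simp [hYe, hneg_hneg]) heX
  refine ⟨_, ⟨Z, hZ, rfl⟩, fun f hf => ⟨?_, ?_⟩⟩
  · by_contra hcon
    rw [Set.mem_union, not_or, Function.notMem_support, Function.notMem_support] at hcon
    have := hZf f
    rw [hcon.1, hcon.2, mul_zero, hadd_zero] at this
    exact hf this
  · rintro rfl
    exact hf hZe

omit [Finite E] in
-- Needed to obtain the underlying matroid in the strong case, so nullity is not yet available and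
-- the height of a modular pair is computed directly in the lattice.
theorem IsStrongCircuitSet.isWeakCircuitSet (h : IsStrongCircuitSet C) : IsWeakCircuitSet C := by
  refine { h.toIsPreCircuitSet with modular_elimination := ?_ }
  intro X hX Y hY hmod e hXY hXe
  have hmem : ∀ i, (![X, Y] : Fin 2 → E → F) i ∈ C := fun i => by fin_cases i <;> assumption
  have hUeq : (⋃ i : Fin 2, Function.support ((![X, Y] : Fin 2 → E → F) i)) =
      Function.support X ∪ Function.support Y := iUnion_fin_two _
  have hUmem : (⋃ i : Fin 2, Function.support ((![X, Y] : Fin 2 → E → F) i)) ∈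
      unionLattice (supports C) := by
    refine ⟨_, ?_, rfl⟩
    rintro _ ⟨i, rfl⟩
    exact ⟨_, hmem i, rfl⟩
  obtain ⟨Z, hZ, hZe, hZf⟩ := h.strong_modular_elimination 1 ![X, Y] hmem
    ⟨fun i => ⟨_, hmem i, rfl⟩, hUmem, by
      have := height_of_isModularPair h.toIsPreCircuitSet.empty_notMem
        h.toIsPreCircuitSet.eq_of_subset hmod (hUeq ▸ hUmem)
      simp only [hUeq]
      rw [this]
      rfl⟩
    (by
      intro hss
      refine hmod.2.2.1 (h.toIsPreCircuitSet.eq_of_subset _ ⟨X, hX, rfl⟩ _ ⟨Y, hY, rfl⟩ ?_)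
      intro x hx
      obtain ⟨i, hi⟩ := Set.mem_iUnion.1 (hss hx)
      rw [Subsingleton.elim i 0] at hi
      exact hi)
    (fun _ => e) (fun i j hij => absurd (Subsingleton.elim j i) hij)
    (fun i => by rw [Subsingleton.elim i 0]; exact ⟨hXY, hXe⟩)
  refine ⟨Z, hZ, hZe 0, fun f => ?_⟩
  have := hZf f
  rw [hyperSumOver_eq_hadd (i := (0 : Fin 2)) (j := 1) (by decide)] at this
  · exact this
  · intro l h0 h1
    fin_cases l
    · exact absurd rfl h0
    · exact absurd rfl h1

end Elimination

/-! ### Uniqueness of the dual and passage to minors. -/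

section Minors

variable {F E : Type*} [Hyperfield F] [Finite E] {M : Matroid E} {C D : Set (E → F)}
  {τ : Involution F} {N : ℕ∞}

/-- The vectors orthogonal to those elements of `C` whose support they meet in at most `N`
elements. -/
def boundedOrthCompl (τ : Involution F) (N : ℕ∞) (C : Set (E → F)) : Set (E → F) :=
  {Y | ∀ X ∈ C, (Function.support X ∩ Function.support Y).encard ≤ N → Orthogonal τ Y X}

theorem orthCompl_eq (τ : Involution F) (C : Set (E → F)) :
    orthCompl τ C = boundedOrthCompl τ ⊤ C := by
  simp [orthCompl, boundedOrthCompl]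

theorem weakOrthCompl_eq (τ : Involution F) (C : Set (E → F)) :
    weakOrthCompl τ C = boundedOrthCompl τ 3 C := by
  have h (S : Set E) : S.ncard ≤ 3 ↔ S.encard ≤ 3 := by
    rw [← S.toFinite.cast_ncard_eq]
    norm_cast
  simp [weakOrthCompl, boundedOrthCompl, h]

/-- For `e ≠ f` in a cocircuit some circuit meets it exactly in `{e, f}`, and orthogonality to that
circuit fixes the ratio of the two entries. -/
theorem eq_smul_of_support_eq (h : IsSignature M C) (hN : 2 ≤ N) {Y Y' : E → F}
    (hY : Y ∈ boundedOrthCompl τ N C) (hY' : Y' ∈ boundedOrthCompl τ N C)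
    (hK : M.IsCocircuit (Function.support Y)) (hs : Function.support Y' = Function.support Y) :
    ∃ a : F, a ≠ 0 ∧ Y = fun e => a * Y' e := by
  obtain ⟨f, hf⟩ := hK.nonempty
  have hYf : Y f ≠ 0 := hf
  have hYf' : Y' f ≠ 0 := (hs ▸ hf : f ∈ Function.support Y')
  refine ⟨Y f * (Y' f)⁻¹, mul_ne_zero hYf (inv_ne_zero hYf'), funext fun e => ?_⟩
  by_cases he : e ∈ Function.support Y
  · by_cases hef : e = f
    · subst hef
      simp [hYf']
    obtain ⟨B, hB, -, hBK⟩ := exists_isBase_inter_eq_singleton hK hf M.empty_indep (by simp)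
    have heB : e ∉ B := fun heB => hef (hBK ▸ ⟨heB, he⟩ : e ∈ ({f} : Set E))
    obtain ⟨X, hX, hXs⟩ := (h.underlying.2 _).1 (hB.fundCircuit_isCircuit (h.mem_ground e) heB)
    have hXB : Function.support X ⊆ insert e B := hXs ▸ M.fundCircuit_subset_insert e B
    have hXe := h.apply_ne_zero_of_subset_insert hB.indep hX hXB
    have hss : Function.support X ∩ Function.support Y ⊆ {e, f} := by
      rintro x ⟨hx, hxY⟩
      exact (hXB hx).imp id fun h' => hBK ▸ ⟨h', hxY⟩
    have hle : (Function.support X ∩ Function.support Y).encard ≤ N := by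
      refine (Set.encard_le_encard hss).trans ((Set.encard_insert_le _ _).trans ?_)
      rw [Set.encard_singleton]
      exact le_trans (by norm_num) hN
    have h1 := (hY X hX hle).eq_neg_of_inter_subset_pair hef (by rwa [Set.inter_comm])
    have h2 := (hY' X hX (by rwa [hs])).eq_neg_of_inter_subset_pair hef
      (by rwa [Set.inter_comm, hs])
    refine mul_right_cancel₀ (fun h0 => hXe (τ.eq_zero_iff.1 h0) : τ.toFun (X e) ≠ 0) ?_
    rw [h1, mul_assoc, h2, mul_hneg, mul_assoc, inv_mul_cancel_left₀ hYf']
  · have he' : e ∉ Function.support Y' := hs ▸ he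
    rw [Function.notMem_support] at he he'
    rw [he, he', mul_zero]

/-- Otherwise a base avoids the support of `Y`, and the fundamental circuit of a point of the
support meets it in that point alone, which contradicts orthogonality. -/
theorem exists_isCocircuit_subset_support (h : IsSignature M C) (hN : 1 ≤ N) {Y : E → F}
    (hY : Y ∈ boundedOrthCompl τ N C) (hY0 : Y ≠ 0) :
    ∃ K ⊆ Function.support Y, M.IsCocircuit K := by
  by_contra! hcon
  have hco : M.Coindep (Function.support Y) := by
    rw [Matroid.coindep_def, Matroid.indep_iff_forall_subset_not_isCircuit (M := M✶) (h.subset_ground _)]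
    exact hcon
  obtain ⟨B, hB, hBs⟩ := hco.compl_spanning.exists_isBase_subset
  obtain ⟨e, he⟩ := Function.support_nonempty_iff.2 hY0
  have heB : e ∉ B := fun h' => (hBs h').2 he
  obtain ⟨X, hX, hXs⟩ := (h.underlying.2 _).1 (hB.fundCircuit_isCircuit (h.mem_ground e) heB)
  have hXB : Function.support X ⊆ insert e B := hXs ▸ M.fundCircuit_subset_insert e B
  have hXe := h.apply_ne_zero_of_subset_insert hB.indep hX hXB
  have hint : Function.support X ∩ Function.support Y = {e} := by
    ext x
    constructor
    · rintro ⟨hx, hxY⟩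
      exact (hXB hx).resolve_right fun h' => (hBs h').2 hxY
    · rintro rfl
      exact ⟨hXe, he⟩
  refine (hY X hX ?_).symm.inter_ne_singleton e hint
  rwa [hint, Set.encard_singleton]

theorem mem_suppMin_iff (h : IsSignature M C) (hN : 2 ≤ N) {S : Set (E → F)}
    (hS : S ⊆ boundedOrthCompl τ N C \ {0})
    (hcov : ∀ K, M.IsCocircuit K → ∃ Y ∈ S, Function.support Y = K) (Y : E → F) :
    Y ∈ suppMin S ↔ Y ∈ S ∧ M.IsCocircuit (Function.support Y) := by
  have hN1 : (1 : ℕ∞) ≤ N := le_trans (by norm_num) hN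
  refine and_congr_right fun hYS => ?_
  constructor
  · intro hmin
    obtain ⟨K, hKY, hK⟩ := exists_isCocircuit_subset_support h hN1 (hS hYS).1 (hS hYS).2
    obtain ⟨Y', hY', rfl⟩ := hcov K hK
    rwa [(hmin Y' hY' hKY).antisymm hKY]
  · intro hYc Y' hY' hss
    obtain ⟨K, hKY, hK⟩ := exists_isCocircuit_subset_support h hN1 (hS hY').1 (hS hY').2
    rw [← hK.isCircuit.eq_of_subset_isCircuit hYc.isCircuit (hKY.trans hss)]
    exact hKY

/-- Recognizes a dual from any scaling-stable supply of orthogonal vectors that realizes every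
cocircuit; the contraction is obtained from it. -/
theorem dualPair_suppMin (h : IsSignature M C) (hN : 2 ≤ N) {S : Set (E → F)}
    (hS : S ⊆ boundedOrthCompl τ N C \ {0}) (hsmul : ∀ Y ∈ S, ∀ a : F, a ≠ 0 →
      (fun e => a * Y e) ∈ S)
    (hcov : ∀ K, M.IsCocircuit K → ∃ Y ∈ S, Function.support Y = K) :
    DualPair τ N M C (suppMin S) := by
  have hmem := mem_suppMin_iff h hN hS hcov
  refine ⟨h, ⟨⟨?_, ?_, ?_⟩, h.underlying.1, ?_⟩, ?_⟩
  · intro h0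
    exact (hS h0.1).2 rfl
  · intro Y hY a ha
    rw [hmem] at hY ⊢
    exact ⟨hsmul Y hY.1 a ha, by rw [support_smul ha Y]; exact hY.2⟩
  · intro Y hY Y' hY' hss
    rw [hmem] at hY hY'
    exact eq_smul_of_support_eq h hN (hS hY.1).1 (hS hY'.1).1 hY.2
      (hY.2.isCircuit.eq_of_subset_isCircuit hY'.2.isCircuit hss).symm
  · intro K
    constructor
    · intro hK
      obtain ⟨Y, hY, rfl⟩ := hcov K hK
      exact ⟨Y, (hmem Y).2 ⟨hY, hK⟩, rfl⟩
    · rintro ⟨Y, hY, rfl⟩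
      exact ((hmem Y).1 hY).2
  · intro X hX Y hY hle
    exact ((hS hY.1).1 X hX hle).symm

/-- The second member of a dual pair is determined by the first one. -/
theorem DualPair.suppMin_eq (h : DualPair τ N M C D) (hN : 2 ≤ N) :
    suppMin (boundedOrthCompl τ N C \ {0}) = D := by
  have hD : ∀ Y ∈ D, Y ∈ boundedOrthCompl τ N C \ {0} := fun Y hY =>
    ⟨fun X hX hle => (h.orth X hX Y hY hle).symm, fun h0 =>
      h.right.pre.zero_notMem (Set.mem_singleton_iff.1 h0 ▸ hY)⟩
  ext Y
  rw [mem_suppMin_iff h.left hN subset_rfl fun K hK => by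
    obtain ⟨Y, hY, hs⟩ := (h.right.underlying.2 K).1 hK
    exact ⟨Y, hD Y hY, hs⟩]
  constructor
  · rintro ⟨hY, hK⟩
    obtain ⟨Y', hY', hs⟩ := (h.right.underlying.2 _).1 hK
    obtain ⟨a, ha, rfl⟩ := eq_smul_of_support_eq h.left hN hY.1 (hD Y' hY').1 hK hs
    exact h.right.pre.smul_mem Y' hY' a ha
  · exact fun hY => ⟨hD Y hY, h.right.isCircuit hY⟩

omit [Finite E] in
theorem restrictSubtype_isCircuit_iff {N : Matroid E} {R : Set E} (hR : N.E = R) (S : Set R) :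
    (N.restrictSubtype R).IsCircuit S ↔ N.IsCircuit (Subtype.val '' S) := by
  have hsub : ∀ T : Set R, Subtype.val '' T ⊆ N.E := fun T => by
    rw [hR]
    exact Subtype.coe_image_subset R T
  have hdep : ∀ T : Set R, (N.restrictSubtype R).Dep T ↔ N.Dep (Subtype.val '' T) := fun T => by
    simp only [Matroid.Dep, Matroid.restrictSubtype_indep_iff, Matroid.restrictSubtype_ground,
      Set.subset_univ, and_true, hsub T]
  rw [Matroid.isCircuit_iff_dep_forall_sdiff_singleton_indep,
    Matroid.isCircuit_iff_dep_forall_sdiff_singleton_indep, hdep]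
  refine and_congr_right fun _ => ?_
  simp [Matroid.restrictSubtype_indep_iff, Set.image_sdiff Subtype.val_injective]

omit [Finite E] in
theorem support_restr (A : Set E) (X : E → F) :
    Subtype.val '' Function.support (restr A X) = Function.support X \ A := by
  ext x
  simp [restr, and_comm]

omit [Finite E] in
theorem isSignature_deletion (h : IsSignature M C) (A : Set E) :
    IsSignature ((M ＼ A).restrictSubtype Aᶜ) (deletion C A) := by
  have hE : (M ＼ A).E = Aᶜ := by
    rw [Matroid.delete_ground, h.underlying.1, Set.compl_eq_univ_sdiff]
  have hsupp : ∀ X : E → F, Function.support X ∩ A = ∅ →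
      Subtype.val '' Function.support (restr A X) = Function.support X := fun X hX => by
    rw [support_restr, sdiff_eq_left, Set.disjoint_iff_inter_eq_empty, hX]
  refine ⟨⟨?_, ?_, ?_⟩, by simp, ?_⟩
  · rintro ⟨X, ⟨hX, hXA⟩, h0⟩
    have := hsupp X hXA
    rw [h0, Function.support_zero, Set.image_empty, eq_comm, Function.support_eq_empty_iff] at this
    exact h.pre.zero_notMem (this ▸ hX)
  · rintro _ ⟨X, ⟨hX, hXA⟩, rfl⟩ a ha
    exact ⟨_, ⟨h.pre.smul_mem X hX a ha, by rw [support_smul ha X, hXA]⟩, rfl⟩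
  · rintro _ ⟨X, ⟨hX, hXA⟩, rfl⟩ _ ⟨Y, ⟨hY, hYA⟩, rfl⟩ hss
    have := Set.image_mono (f := Subtype.val) hss
    rw [hsupp X hXA, hsupp Y hYA] at this
    obtain ⟨a, ha, rfl⟩ := h.pre.incomparable X hX Y hY this
    exact ⟨a, ha, rfl⟩
  · intro S
    rw [restrictSubtype_isCircuit_iff hE, Matroid.delete_isCircuit_iff, h.underlying.2]
    constructor
    · rintro ⟨⟨X, hX, hXS⟩, hd⟩
      have hXA : Function.support X ∩ A = ∅ := by
        rw [hXS]
        exact Set.disjoint_iff_inter_eq_empty.1 hd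
      refine ⟨restr A X, ⟨X, ⟨hX, hXA⟩, rfl⟩, ?_⟩
      exact Set.image_injective.2 Subtype.val_injective ((hsupp X hXA).trans hXS)
    · rintro ⟨_, ⟨X, ⟨hX, hXA⟩, rfl⟩, rfl⟩
      rw [hsupp X hXA]
      exact ⟨⟨X, hX, rfl⟩, Set.disjoint_iff_inter_eq_empty.2 hXA⟩

omit [Finite E] in
theorem restrictSubtype_delete_dual (hE : M.E = Set.univ) (A : Set E) :
    ((M ＼ A).restrictSubtype Aᶜ)✶ = (M✶ ／ A).restrictSubtype Aᶜ := by
  rw [Matroid.restrictSubtype_dual', Matroid.dual_delete]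
  rw [Matroid.delete_ground, hE, Set.compl_eq_univ_sdiff]

/-- A circuit vector vanishing on `A` has the same inner product and the same common support with
`Y` as with the restriction of `Y`. Every cocircuit of the deletion is `K' \ A` for some cocircuit
`K'` of `M`. -/
theorem DualPair.deletion_contraction (h : DualPair τ N M C D) (hN : 2 ≤ N) (A : Set E) :
    DualPair τ N ((M ＼ A).restrictSubtype Aᶜ) (deletion C A) (contraction D A) := by
  refine dualPair_suppMin (isSignature_deletion h.left A) hN ?_ ?_ ?_
  · rintro _ ⟨⟨Y, hY, rfl⟩, hY0⟩
    refine ⟨?_, hY0⟩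
    rintro _ ⟨X, ⟨hX, hXA⟩, rfl⟩ hle
    have hX0 : ∀ e ∈ A, X e = 0 := fun e he => by
      by_contra h0
      exact (hXA ▸ ⟨h0, he⟩ : e ∈ (∅ : Set E))
    have hint : Function.support X ∩ Function.support Y =
        Subtype.val '' (Function.support (restr A X) ∩ Function.support (restr A Y)) := by
      rw [Set.image_inter Subtype.val_injective, support_restr, support_restr]
      ext x
      by_cases hx : x ∈ A
      · simp [hx, hX0 x hx]
      · simp [hx]
    have horth := (h.orth X hX Y hY (by
      rwa [hint, Subtype.val_injective.encard_image])).symm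
    unfold Orthogonal at horth ⊢
    rwa [hyperSumOver_eq_of_injective (Subtype.val : ↥Aᶜ → E) Subtype.val_injective
      (x := fun e => restr A Y e * τ.toFun (restr A X e))
      (y := fun e => Y e * τ.toFun (X e)) (fun _ => rfl)]
    intro x hx
    rw [Subtype.range_coe_subtype] at hx
    rw [hX0 x (by simpa using hx), τ.map_zero, mul_zero]
  · rintro _ ⟨⟨Y, hY, rfl⟩, hY0⟩ a ha
    refine ⟨⟨_, h.right.pre.smul_mem Y hY a ha, rfl⟩, fun h0 => hY0 ?_⟩
    rw [Set.mem_singleton_iff, ← Function.support_eq_empty_iff] at h0 ⊢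
    exact (support_smul ha (restr A Y)).symm.trans h0
  · intro K hK
    have hK' := hK.isCircuit
    rw [restrictSubtype_delete_dual h.left.underlying.1, restrictSubtype_isCircuit_iff (by
      rw [Matroid.contract_ground, Matroid.dual_ground, h.left.underlying.1,
        Set.compl_eq_univ_sdiff])] at hK'
    obtain ⟨K', hK'c, hss, hss'⟩ := hK'.exists_subset_isCircuit_of_contract
    obtain ⟨Y, hY, rfl⟩ := (h.right.underlying.2 _).1 hK'c
    have hYK : Function.support (restr A Y) = K := by
      refine Set.image_injective.2 Subtype.val_injective ?_
      rw [support_restr]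
      refine Set.Subset.antisymm (fun x hx => (hss' hx.1).resolve_right hx.2) fun x hx => ?_
      refine ⟨hss hx, ?_⟩
      obtain ⟨y, -, rfl⟩ := hx
      exact y.2
    refine ⟨restr A Y, ⟨⟨Y, hY, rfl⟩, fun h0 => ?_⟩, hYK⟩
    rw [Set.mem_singleton_iff.1 h0, Function.support_zero] at hYK
    exact hK.nonempty.ne_empty hYK.symm

theorem DualPair.contraction_deletion (h : DualPair τ N M C D) (hN : 2 ≤ N) (A : Set E) :
    DualPair τ N ((M ／ A).restrictSubtype Aᶜ) (contraction C A) (deletion D A) := by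
  have := (h.symm.deletion_contraction hN A).symm
  rwa [restrictSubtype_delete_dual h.right.underlying.1, Matroid.dual_dual] at this

end Minors

end HypMat

theorem theorem3p25 {F E : Type*} [HypMat.Hyperfield F] [Finite E] (τ : HypMat.Involution F)
    (C : Set (E → F)) (A : Set E) :
    (HypMat.IsStrongCircuitSet C →
      ∃ M : Matroid E, HypMat.IsUnderlyingMatroid M C ∧
        HypMat.IsStrongCircuitSet (HypMat.deletion C A) ∧
        HypMat.IsUnderlyingMatroid ((M ＼ A).restrictSubtype Aᶜ) (HypMat.deletion C A) ∧
        HypMat.IsStrongCircuitSet (HypMat.contraction C A) ∧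
        HypMat.IsUnderlyingMatroid ((M ／ A).restrictSubtype Aᶜ) (HypMat.contraction C A) ∧
        HypMat.IsStrongCircuitSet (HypMat.strongDual τ C) ∧
        HypMat.IsUnderlyingMatroid M✶ (HypMat.strongDual τ C) ∧
        HypMat.strongDual τ (HypMat.deletion C A) =
          HypMat.contraction (HypMat.strongDual τ C) A ∧
        HypMat.strongDual τ (HypMat.contraction C A) =
          HypMat.deletion (HypMat.strongDual τ C) A) ∧
    (HypMat.IsWeakCircuitSet C →
      ∃ M : Matroid E, HypMat.IsUnderlyingMatroid M C ∧
        HypMat.IsWeakCircuitSet (HypMat.deletion C A) ∧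
        HypMat.IsUnderlyingMatroid ((M ＼ A).restrictSubtype Aᶜ) (HypMat.deletion C A) ∧
        HypMat.IsWeakCircuitSet (HypMat.contraction C A) ∧
        HypMat.IsUnderlyingMatroid ((M ／ A).restrictSubtype Aᶜ) (HypMat.contraction C A) ∧
        HypMat.IsWeakCircuitSet (HypMat.weakDual τ C) ∧
        HypMat.IsUnderlyingMatroid M✶ (HypMat.weakDual τ C) ∧
        HypMat.weakDual τ (HypMat.deletion C A) =
          HypMat.contraction (HypMat.weakDual τ C) A ∧
        HypMat.weakDual τ (HypMat.contraction C A) =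
          HypMat.deletion (HypMat.weakDual τ C) A) := by
  open HypMat in
  constructor
  · intro hC
    obtain ⟨M, hM⟩ := hC.isWeakCircuitSet.exists_isSignature
    obtain ⟨D, hD⟩ := exists_dualPair τ hM (hM.isStrongCircuitSet_iff.1 hC) le_top
    have hdual : ∀ {E' : Type _} [Finite E'] {M' : Matroid E'} {C' D' : Set (E' → F)},
        DualPair τ ⊤ M' C' D' → strongDual τ C' = D' := fun h => by
      rw [strongDual, orthCompl_eq, h.suppMin_eq le_top]
    have hdel := hD.deletion_contraction le_top A
    have hcon := hD.contraction_deletion le_top A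
    -- With the dual replaced by `D`, the two duality formulas are uniqueness of the second member
    -- for the dual pairs of the minors.
    rw [hdual hD]
    exact ⟨M, hM.underlying, hdel.left.isStrongCircuitSet_iff.2 hdel.modularElim,
      hdel.left.underlying, hcon.left.isStrongCircuitSet_iff.2 hcon.modularElim,
      hcon.left.underlying, hD.right.isStrongCircuitSet_iff.2 hD.symm.modularElim,
      hD.right.underlying, hdual hdel, hdual hcon⟩
  · intro hC
    obtain ⟨M, hM⟩ := hC.exists_isSignature
    obtain ⟨D, hD⟩ := exists_dualPair τ hM (hM.isWeakCircuitSet_iff.1 hC) le_rfl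
    have h23 : (2 : ℕ∞) ≤ 3 := by norm_num
    have hdual : ∀ {E' : Type _} [Finite E'] {M' : Matroid E'} {C' D' : Set (E' → F)},
        DualPair τ 3 M' C' D' → weakDual τ C' = D' := fun h => by
      rw [weakDual, weakOrthCompl_eq, h.suppMin_eq h23]
    have hdel := hD.deletion_contraction h23 A
    have hcon := hD.contraction_deletion h23 A
    rw [hdual hD]
    exact ⟨M, hM.underlying, hdel.left.isWeakCircuitSet_iff.2 hdel.modularElim,
      hdel.left.underlying, hcon.left.isWeakCircuitSet_iff.2 hcon.modularElim,
      hcon.left.underlying, hD.right.isWeakCircuitSet_iff.2 hD.symm.modularElim,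
      hD.right.underlying, hdual hdel, hdual hcon⟩
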